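/- Let $d,n\ge 1$ be integers, $\sigma^2\in(0,\infty)$, and let $P_X$ be a probability distribution on $\mathbb R^d$ with $\mathbb E\|X\|^2<\infty$ and $\mathbb P(\langle w,X\rangle=0)<1$ for every $w\in\mathbb R^d\setminus\{0\}$, where $X\sim P_X$. Let $\mathcal P_{\mathrm{Gauss}}(P_X,\sigma^2)$ be the set of laws of $(X,\langle w^*,X\rangle+\eta)$ with $(X,\eta)\sim P_X\times\mathcal N(0,\sigma^2)$ and $w^*\in\mathbb R^d$. For a distribution $P$ on $\mathbb R^d\times\mathbb R$ and $w\in\mathbb R^d$ put $E_P(w)=\mathbb E_{(X,Y)\sim P}\big[(\langle w,X\rangle-Y)^2/2\big]$ and $\mathcal E_P(w)=E_P(w)-\inf_{v\in\mathbb R^d}E_P(v)$. For a random variable $V$ with values in $[0,\infty]$ and $p\in(0,1)$ let $Q_V(p)=\inf\{t\in[0,\infty):\mathbb P(V\le t)\ge p\}$, with $\inf\emptyset=\infty$. For $\delta\in(0,1)$ define the minimax quantile risk $$R^*_{n,\delta}(\mathcal P)=\inf_{\hat w}\ \sup_{P\in\mathcal P}\ Q_{\mathcal E_P(\hat w((X_i,Y_i)_{i=1}^n))}(1-\delta),$$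 where $(X_i,Y_i)_{i=1}^n$ are i.i.d. from $P$ and the infimum is over all measurable procedures $\hat w:(\mathbb R^d\times\mathbb R)^n\to\mathbb R^d$. Let $\Sigma=\mathbb E[XX^T]$ and, for $X_1,\dots,X_n$ i.i.d. from $P_X$, let $\widehat\Sigma_n=\frac1n\sum_{i=1}^nX_iX_i^T$, $\widetilde\Sigma_n=\Sigma^{-1/2}\widehat\Sigma_n\Sigma^{-1/2}$ and $\varepsilon_n=\mathbb P(\operatorname{rank}(\widehat\Sigma_n)<d)$. Set $\operatorname{Tr}(\widetilde\Sigma_n^{-1})=\infty$ when $\widetilde\Sigma_n$ is not invertible, and let $W$ be a $[0,\infty]$-valued random variable jointly distributed with $(X_i)_{i=1}^n$ such that $W\mid(X_i)_{i=1}^n\sim\mathrm{Exp}(\lambda_{\min}(\widetilde\Sigma_n))$, where $\mathrm{Exp}(\lambda)$ is the exponential distribution with rate $\lambda$ and $\mathrm{Exp}(0)$ is the unit mass at $\infty$. Then for all $\delta\in(0,(1-\varepsilon_n)/4)$, $$R^*_{n,\varepsilon_n+\delta}(\mathcal P_{\mathrm{Gauss}}(P_X,\sigma^2))\le 2\cdot\frac{\sigma^2}{n}\Big[Q_{\operatorname{Tr}(\widetilde\Sigma_n^{-1})}(1-\varepsilon_n-\delta/2)+Q_W(1-\varepsilon_n-\delta/2)\Big]$$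 and $$R^*_{n,\varepsilon_n+\delta}(\mathcal P_{\mathrm{Gauss}}(P_X,\sigma^2))\ge \frac1{6428}\cdot\frac{\sigma^2}{n}\Big[Q_{\operatorname{Tr}(\widetilde\Sigma_n^{-1})}(1-\varepsilon_n-4\delta)+Q_W(1-\varepsilon_n-4\delta)\Big].$$ -/

import Mathlib

open MeasureTheory ProbabilityTheory
open scoped NNReal ENNReal RealInnerProductSpace

namespace QuantileRegression

noncomputable section

/-- The quantile of level `p` of a `[0, ∞]`-valued random variable `X` under `μ`, that is
`inf {t ∈ [0, ∞) | μ (X ≤ t) ≥ p}`, with value `∞` when there is no such `t`. -/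
def quantile {Ω : Type*} [MeasurableSpace Ω] (μ : Measure Ω) (X : Ω → ℝ≥0∞) (p : ℝ) : ℝ≥0∞ :=
  ⨅ (t : ℝ≥0) (_ : p ≤ μ.real {ω | X ω ≤ (t : ℝ≥0∞)}), (t : ℝ≥0∞)

/-! ### Linear regression and its minimax quantile risk -/

/-- The square error function `e(t) = t² / 2`. -/
def squareError (t : ℝ) : ℝ := t ^ 2 / 2

/-- The expected error `E(w) = 𝔼[e(⟨w, X⟩ - Y)]` for `(X, Y) ∼ P`. -/
def expectedError {d : ℕ} (e : ℝ → ℝ) (P : Measure (EuclideanSpace ℝ (Fin d) × ℝ))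
    (w : EuclideanSpace ℝ (Fin d)) : ℝ :=
  ∫ z, e (⟪w, z.1⟫ - z.2) ∂P

/-- The excess expected error `E(w) - inf_v E(v)`. -/
def excessError {d : ℕ} (e : ℝ → ℝ) (P : Measure (EuclideanSpace ℝ (Fin d) × ℝ))
    (w : EuclideanSpace ℝ (Fin d)) : ℝ :=
  expectedError e P w - ⨅ v, expectedError e P v

/-- The quantile risk at failure probability `δ` of the procedure `wh` on the distribution `P`:
the quantile of level `1 - δ` of the (nonnegative) excess error of `wh` evaluated on `n` i.i.d.
samples from `P`. -/
def quantileRisk {d : ℕ} (n : ℕ) (δ : ℝ) (e : ℝ → ℝ)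
    (P : Measure (EuclideanSpace ℝ (Fin d) × ℝ))
    (wh : (Fin n → EuclideanSpace ℝ (Fin d) × ℝ) → EuclideanSpace ℝ (Fin d)) : ℝ≥0∞ :=
  quantile (Measure.pi fun _ : Fin n => P)
    (fun D => ENNReal.ofReal (excessError e P (wh D))) (1 - δ)

/-- The minimax quantile risk over a class `C` of distributions: the infimum over all (measurable)
procedures of the worst-case quantile risk. -/
def minimaxQuantileRisk {d : ℕ} (n : ℕ) (δ : ℝ) (e : ℝ → ℝ)
    (C : Set (Measure (EuclideanSpace ℝ (Fin d) × ℝ))) : ℝ≥0∞ :=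
  ⨅ (wh : (Fin n → EuclideanSpace ℝ (Fin d) × ℝ) → EuclideanSpace ℝ (Fin d))
    (_ : Measurable wh), ⨆ P ∈ C, quantileRisk n δ e P wh

/-- The class of laws of `(X, ⟨w, X⟩ + η)` with `(X, η) ∼ P_X × 𝒩(0, σ²)`, where `w` ranges over
`ℝᵈ`; the parameter `v` is the variance `σ²`. -/
def gaussClass {d : ℕ} (PX : Measure (EuclideanSpace ℝ (Fin d))) (v : ℝ≥0) :
    Set (Measure (EuclideanSpace ℝ (Fin d) × ℝ)) :=
  {P | ∃ w : EuclideanSpace ℝ (Fin d),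
    P = (PX.prod (gaussianReal 0 v)).map (fun z => (z.1, ⟪w, z.1⟫ + z.2))}

/-! ### Covariance matrices -/

/-- The matrix `Σ = 𝔼[X Xᵀ]`. -/
def covMatrix {d : ℕ} (PX : Measure (EuclideanSpace ℝ (Fin d))) : Matrix (Fin d) (Fin d) ℝ :=
  Matrix.of fun a b => ∫ x, x a * x b ∂PX

/-- The sample covariance matrix `n⁻¹ ∑ᵢ Xᵢ Xᵢᵀ`. -/
def sampleCov {d n : ℕ} (x : Fin n → EuclideanSpace ℝ (Fin d)) : Matrix (Fin d) (Fin d) ℝ :=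
  Matrix.of fun a b => (n : ℝ)⁻¹ * ∑ i, x i a * x i b

open scoped MatrixOrder in
/-- The matrix `S^{-1/2}`: the inverse of the positive semidefinite square root of `S`. -/
def invSqrt {d : ℕ} (S : Matrix (Fin d) (Fin d) ℝ) : Matrix (Fin d) (Fin d) ℝ :=
  (CFC.sqrt S)⁻¹

/-- The whitened sample covariance matrix `Σ^{-1/2} Σ̂ₙ Σ^{-1/2}`. -/
def whitenedCov {d n : ℕ} (PX : Measure (EuclideanSpace ℝ (Fin d)))
    (x : Fin n → EuclideanSpace ℝ (Fin d)) : Matrix (Fin d) (Fin d) ℝ :=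
  invSqrt (covMatrix PX) * sampleCov x * invSqrt (covMatrix PX)

/-- The probability `εₙ` that the sample covariance matrix is singular. -/
def singularProb {d : ℕ} (PX : Measure (EuclideanSpace ℝ (Fin d))) (n : ℕ) : ℝ :=
  (Measure.pi fun _ : Fin n => PX).real {x | (sampleCov x).rank < d}

open scoped Classical in
/-- `Tr(A⁻¹)` as an element of `[0, ∞]` for a positive semidefinite `A`, equal to `∞` when `A` is
not invertible. -/
def traceInv {d : ℕ} (A : Matrix (Fin d) (Fin d) ℝ) : ℝ≥0∞ :=
  if IsUnit A then ENNReal.ofReal (A⁻¹).trace else ∞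

/-- The smallest eigenvalue of a (nonempty) real symmetric matrix. -/
def lambdaMin {d : ℕ} (A : Matrix (Fin d) (Fin d) ℝ) : ℝ := sInf (spectrum ℝ A)

/-! ### The variable with conditional law `Exp (λ_min)` -/

open scoped Classical in
/-- The exponential distribution with rate `r ≥ 0` on `[0, ∞]`, with `Exp(0)` the unit mass
at `∞`. -/
def expLaw (r : ℝ) : Measure ℝ≥0∞ :=
  if 0 < r then (expMeasure r).map ENNReal.ofReal else Measure.dirac ∞

theorem measurable_expLaw : Measurable expLaw := by
  classical
  unfold expLaw
  refine Measurable.ite measurableSet_Ioi ?_ measurable_const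
  refine (Measure.measurable_map _ ENNReal.measurable_ofReal).comp ?_
  refine Measure.measurable_of_measurable_coe _ fun s hs => ?_
  unfold expMeasure gammaMeasure
  simp only [withDensity_apply _ hs]
  refine Measurable.lintegral_prod_right' (f := fun p : ℝ × ℝ => gammaPDF 1 p.1 p.2) ?_
  unfold gammaPDF gammaPDFReal
  refine ENNReal.measurable_ofReal.comp (Measurable.ite ?_ ?_ measurable_const)
  · exact measurableSet_le measurable_const measurable_snd
  · fun_prop

instance isProbabilityMeasure_expLaw (r : ℝ) : IsProbabilityMeasure (expLaw r) := by
  unfold expLaw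
  split_ifs with h
  · have := isProbabilityMeasure_expMeasure h
    exact Measure.isProbabilityMeasure_map ENNReal.measurable_ofReal.aemeasurable
  · infer_instance

open scoped MatrixOrder in
theorem isHermitian_invSqrt {d : ℕ} (S : Matrix (Fin d) (Fin d) ℝ) : (invSqrt S).IsHermitian :=
  Matrix.IsHermitian.inv (Matrix.nonneg_iff_posSemidef.mp (CFC.sqrt_nonneg S)).1

theorem isHermitian_sampleCov {d n : ℕ} (x : Fin n → EuclideanSpace ℝ (Fin d)) :
    (sampleCov x).IsHermitian := by
  ext a b
  simp [sampleCov, mul_comm]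

theorem isHermitian_whitenedCov {d n : ℕ} (PX : Measure (EuclideanSpace ℝ (Fin d)))
    (x : Fin n → EuclideanSpace ℝ (Fin d)) : (whitenedCov PX x).IsHermitian := by
  have h := Matrix.isHermitian_mul_mul_conjTranspose (invSqrt (covMatrix PX))
    (isHermitian_sampleCov x)
  rwa [(isHermitian_invSqrt (covMatrix PX)).eq] at h

theorem continuous_whitenedCov {d n : ℕ} (PX : Measure (EuclideanSpace ℝ (Fin d))) :
    Continuous (whitenedCov PX : (Fin n → EuclideanSpace ℝ (Fin d)) → _) := by
  have h : Continuous (sampleCov : (Fin n → EuclideanSpace ℝ (Fin d)) → _) := by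
    refine continuous_matrix fun a b => ?_
    simp only [sampleCov, Matrix.of_apply]
    fun_prop
  unfold whitenedCov
  fun_prop

open scoped MatrixOrder in
theorem le_lambdaMin_iff {d : ℕ} (hd : 0 < d) {A : Matrix (Fin d) (Fin d) ℝ}
    (hA : A.IsHermitian) (c : ℝ) :
    c ≤ lambdaMin A ↔ ∀ v : Fin d → ℝ, c * (v ⬝ᵥ v) ≤ v ⬝ᵥ A.mulVec v := by
  have : Nonempty (Fin d) := ⟨⟨0, hd⟩⟩
  have hs := hA.spectrum_real_eq_range_eigenvalues
  have hne : (spectrum ℝ A).Nonempty := by rw [hs]; exact Set.range_nonempty _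
  have hfin : (spectrum ℝ A).Finite := by rw [hs]; exact Set.finite_range _
  unfold lambdaMin
  rw [le_csInf_iff hfin.bddBelow hne]
  have h1 := algebraMap_le_iff_le_spectrum (R := ℝ) (r := c) (a := A) (ha := hA.isSelfAdjoint)
  rw [← h1, Matrix.le_iff, Matrix.posSemidef_iff_dotProduct_mulVec]
  have hH : (A - algebraMap ℝ (Matrix (Fin d) (Fin d) ℝ) c).IsHermitian := by
    refine hA.sub ?_
    ext i j
    simp [Matrix.algebraMap_matrix_apply, eq_comm]
  refine ⟨fun h v => ?_, fun h => ⟨hH, fun v => ?_⟩⟩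
  · have := h.2 v
    simp [Matrix.sub_mulVec, Algebra.algebraMap_eq_smul_one, Matrix.smul_mulVec] at this
    linarith
  · have := h v
    simp [Matrix.sub_mulVec, Algebra.algebraMap_eq_smul_one, Matrix.smul_mulVec]
    linarith

theorem measurable_lambdaMin_whitenedCov {d n : ℕ} (PX : Measure (EuclideanSpace ℝ (Fin d))) :
    Measurable fun x : Fin n → EuclideanSpace ℝ (Fin d) => lambdaMin (whitenedCov PX x) := by
  rcases Nat.eq_zero_or_pos d with rfl | hd
  · have : (fun x : Fin n → EuclideanSpace ℝ (Fin 0) => lambdaMin (whitenedCov PX x))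
        = fun _ => lambdaMin (0 : Matrix (Fin 0) (Fin 0) ℝ) := by
      funext x
      exact congrArg lambdaMin (Subsingleton.elim _ _)
    rw [this]
    exact measurable_const
  · refine measurable_of_Ici fun c => ?_
    have : (fun x : Fin n → EuclideanSpace ℝ (Fin d) => lambdaMin (whitenedCov PX x)) ⁻¹' Set.Ici c
        = ⋂ v : Fin d → ℝ, {x | c * (v ⬝ᵥ v) ≤ v ⬝ᵥ (whitenedCov PX x).mulVec v} := by
      ext x
      simp [le_lambdaMin_iff hd (isHermitian_whitenedCov PX x)]
    rw [this]
    refine IsClosed.measurableSet (isClosed_iInter fun v => isClosed_le continuous_const ?_)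
    have := continuous_whitenedCov (n := n) PX
    fun_prop

/-- The conditional distribution `W | (Xᵢ) ∼ Exp(λ_min(Σ̃ₙ))`. -/
def expKernel {d : ℕ} (PX : Measure (EuclideanSpace ℝ (Fin d))) (n : ℕ) :
    Kernel (Fin n → EuclideanSpace ℝ (Fin d)) ℝ≥0∞ where
  toFun x := expLaw (lambdaMin (whitenedCov PX x))
  measurable' := measurable_expLaw.comp (measurable_lambdaMin_whitenedCov PX)

instance isMarkovKernel_expKernel {d : ℕ} (PX : Measure (EuclideanSpace ℝ (Fin d))) (n : ℕ) :
    IsMarkovKernel (expKernel PX n) :=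
  ⟨fun x => isProbabilityMeasure_expLaw (lambdaMin (whitenedCov PX x))⟩

/-- The joint law of `((Xᵢ), W)`, where `(Xᵢ) ∼ P_Xⁿ` and `W | (Xᵢ) ∼ Exp(λ_min(Σ̃ₙ))`. -/
def jointLaw {d : ℕ} (PX : Measure (EuclideanSpace ℝ (Fin d))) (n : ℕ) :
    Measure ((Fin n → EuclideanSpace ℝ (Fin d)) × ℝ≥0∞) :=
  (Measure.pi fun _ : Fin n => PX) ⊗ₘ expKernel PX n

/-- The quantile of level `p` of `Tr(Σ̃ₙ⁻¹)`. -/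
def traceQuantile {d : ℕ} (PX : Measure (EuclideanSpace ℝ (Fin d))) (n : ℕ) (p : ℝ) : ℝ≥0∞ :=
  quantile (Measure.pi fun _ : Fin n => PX) (fun x => traceInv (whitenedCov PX x)) p

/-- The quantile of level `p` of `W`. -/
def expQuantile {d : ℕ} (PX : Measure (EuclideanSpace ℝ (Fin d))) (n : ℕ) (p : ℝ) : ℝ≥0∞ :=
  quantile (jointLaw PX n) (fun z => z.2) p

end

end QuantileRegression

namespace QuantileRegression

/-! ### Estimates for independent standard normal variables -/

/-! Since the noise is centred, the excess error of `u` under parameter `w` is `‖Σ^{1/2}(u - w)‖² /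
2`. Fix the design and let `l j` be the eigenvalues of the whitened sample covariance.

Upper bound: in the eigenbasis, the whitened error of least squares has independent centred Gaussian
coordinates of variance `σ² / (n * l j)`. A Chernoff bound (`stdNormalPi_tail_le`) shows that the
excess error exceeds `2σ²/n * (Tr + b)` with probability at most `exp (-λ_min b)`, which is the
conditional probability of `W > b` (`leastSquares_tail`). The events `Tr ≤ a` and `W ≤ b` both lie
in the nonsingular event, of mass `1 - ε`; if each has mass at least `1 - ε - δ/2`, their
intersection has mass at least `1 - ε - δ`.

Lower bound: put the prior `T Σ^{-1/2} N(0, I)` on the parameter. The posterior has independent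
coordinates of variance `σ² / (n * l j + σ²/T²)` around a mean determined by the data, so no
procedure hits a ball of given radius more often than the best-placed ball does under the posterior
(`bayes_ball_le`). As `T → ∞` this probability tends to `0` on singular designs. On the others it is
bounded in two ways: by a Laplace transform estimate governed by the trace
(`stdNormalPi_small_ball_le`), and by anti-concentration of the worst coordinate, governed by
`λ_min` (`stdNormalPi_ball_le`). Both have the form `3/4 + ψ/4`, with `ψ` the conditional
probability of `Tr ≤ q` or of `W ≤ q`. A procedure succeeding with probability `1 - ε - δ` then
forces `∫ ψ ≥ 1 - ε - 4δ` (`le_minimaxQuantileRisk_gaussClass`), so `q` cannot lie below the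
corresponding quantile. Averaging the two bounds gives the sum of quantiles. -/

theorem integral_stdNormal (f : ℝ → ℝ) :
    ∫ x, f x ∂(gaussianReal 0 1)
      = (√(2 * Real.pi))⁻¹ * ∫ x, Real.exp (-(1 / 2) * x ^ 2) * f x := by
  rw [integral_gaussianReal_eq_integral_smul one_ne_zero, ← integral_const_mul]
  refine integral_congr_ae (Filter.Eventually.of_forall fun x => ?_)
  simp only [gaussianPDFReal, smul_eq_mul, NNReal.coe_one, mul_one, sub_zero]
  rw [mul_assoc]
  congr 3
  ring

theorem inv_sqrt_two_pi_mul {A : ℝ} (hA : 0 < A) :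
    (√(2 * Real.pi))⁻¹ * √(Real.pi / A) = 1 / √(2 * A) := by
  have hp := Real.pi_pos
  rw [← Real.sqrt_inv, ← Real.sqrt_mul (by positivity), ← Real.sqrt_one,
    ← Real.sqrt_div zero_le_one]
  congr 1
  field_simp

/-- The Laplace transform of a noncentral squared Gaussian variable is at most the central one. -/
theorem integral_exp_neg_sq_le (s σ a : ℝ) (hs : 0 ≤ s) :
    ∫ x, Real.exp (-s * (σ * x - a) ^ 2) ∂(gaussianReal 0 1) ≤ 1 / √(1 + 2 * s * σ ^ 2) := by
  have hA : 0 < s * σ ^ 2 + 1 / 2 := by positivity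
  set A := s * σ ^ 2 + 1 / 2 with hAdef
  rw [integral_stdNormal]
  -- Completing the square: the exponent is `-A(x - c)² - (s a² - A c²)`, and the last bracket is
  -- nonnegative, so the shift `a` only lowers the integral.
  set c := s * σ * a / A with hc
  have key : ∀ x : ℝ, Real.exp (-(1 / 2) * x ^ 2) * Real.exp (-s * (σ * x - a) ^ 2)
      ≤ Real.exp (-A * (x - c) ^ 2) := by
    intro x
    rw [← Real.exp_add]
    apply Real.exp_le_exp.mpr
    have h1 : A * c = s * σ * a := by rw [hc]; field_simp
    have h2 : A * c ^ 2 ≤ s * a ^ 2 := by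
      have : A * (A * c ^ 2) ≤ A * (s * a ^ 2) := by
        have : A * (A * c ^ 2) = (s * σ * a) ^ 2 := by rw [← h1]; ring
        rw [this, hAdef]
        nlinarith [mul_nonneg hs (sq_nonneg a)]
      exact le_of_mul_le_mul_left this hA
    have h3 : -A * (x - c) ^ 2 = -A * x ^ 2 + 2 * (A * c) * x - A * c ^ 2 := by ring
    rw [h3, h1, hAdef]
    rw [hAdef] at h2
    nlinarith
  have hint : Integrable (fun x : ℝ => Real.exp (-A * (x - c) ^ 2)) :=
    (integrable_exp_neg_mul_sq hA).comp_sub_right c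
  have hle : ∫ x, Real.exp (-(1 / 2) * x ^ 2) * Real.exp (-s * (σ * x - a) ^ 2)
      ≤ ∫ x, Real.exp (-A * (x - c) ^ 2) :=
    integral_mono_of_nonneg (Filter.Eventually.of_forall fun x => by positivity) hint
      (Filter.Eventually.of_forall key)
  rw [integral_sub_right_eq_self (fun x : ℝ => Real.exp (-A * x ^ 2)), integral_gaussian] at hle
  calc _ ≤ (√(2 * Real.pi))⁻¹ * √(Real.pi / A) := by gcongr
    _ = 1 / √(2 * A) := inv_sqrt_two_pi_mul hA
    _ = _ := by congr 2; rw [hAdef]; ring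

/-- Since `(1 + u)²(1 - u) - 1 = u(1 - u - u²) ≥ 0` on `[0, 1/2]`, already `1 + u` dominates. -/
theorem inv_sqrt_one_sub_le_exp {u : ℝ} (hu : 0 ≤ u) (hu' : u ≤ 1 / 2) :
    1 / √(1 - u) ≤ Real.exp u := by
  have h1 : 0 < 1 - u := by linarith
  rw [div_le_iff₀ (Real.sqrt_pos.mpr h1)]
  have h2 : 1 + u ≤ Real.exp u := by linarith [Real.add_one_le_exp u]
  have h3 : 1 ≤ (1 + u) * √(1 - u) := by
    rw [← Real.sqrt_sq (show (0 : ℝ) ≤ 1 + u by linarith), ← Real.sqrt_mul (by positivity)]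
    apply Real.le_sqrt_of_sq_le
    nlinarith [mul_nonneg hu hu]
  exact h3.trans (by gcongr)

theorem integral_exp_sq_le (s σ : ℝ) (hs : 0 ≤ s) (h : 2 * s * σ ^ 2 ≤ 1 / 2) :
    Integrable (fun x => Real.exp (s * (σ * x) ^ 2)) (gaussianReal 0 1) ∧
    ∫ x, Real.exp (s * (σ * x) ^ 2) ∂(gaussianReal 0 1) ≤ Real.exp (2 * s * σ ^ 2) := by
  have hA : 0 < 1 / 2 - s * σ ^ 2 := by linarith
  have e : ∀ x : ℝ, Real.exp (-(1 / 2) * x ^ 2) * Real.exp (s * (σ * x) ^ 2)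
      = Real.exp (-(1 / 2 - s * σ ^ 2) * x ^ 2) := by
    intro x
    rw [← Real.exp_add]; congr 1; ring
  have h1 : ∫ x, Real.exp (s * (σ * x) ^ 2) ∂(gaussianReal 0 1)
      = 1 / √(1 - 2 * s * σ ^ 2) := by
    rw [integral_stdNormal]
    simp_rw [e]
    rw [integral_gaussian, inv_sqrt_two_pi_mul hA]
    congr 2; ring
  refine ⟨?_, ?_⟩
  · apply Integrable.of_integral_ne_zero
    rw [h1]
    have : 0 < 1 - 2 * s * σ ^ 2 := by linarith
    positivity
  · rw [h1]
    exact inv_sqrt_one_sub_le_exp (by positivity) h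

/-- Only the linear term of the product is kept, so that the small ball bound depends on the
variances through their sum alone. -/
theorem one_add_sum_le_prod {ι : Type*} (S : Finset ι) (f : ι → ℝ) (hf : ∀ i, 0 ≤ f i) :
    1 + ∑ i ∈ S, f i ≤ ∏ i ∈ S, (1 + f i) := by
  classical
  induction S using Finset.induction_on with
  | empty => simp
  | insert a S ha ih =>
    rw [Finset.sum_insert ha, Finset.prod_insert ha]
    have : 0 ≤ ∑ i ∈ S, f i := Finset.sum_nonneg fun i _ => hf i
    nlinarith [hf a]

/-- The standard Gaussian measure on `ι → ℝ`. -/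
noncomputable abbrev stdNormalPi (ι : Type*) [Fintype ι] : Measure (ι → ℝ) :=
  Measure.pi fun _ : ι => gaussianReal 0 1

variable {ι : Type*} [Fintype ι]

/-- A small ball estimate for a Gaussian vector with independent coordinates. -/
theorem stdNormalPi_small_ball_le (σ a : ι → ℝ) {t : ℝ} (ht : 0 < t) :
    (stdNormalPi ι).real {z | (∑ j, (σ j * z j - a j) ^ 2) / 2 ≤ t}
      ≤ Real.exp 1 / √(1 + (∑ j, σ j ^ 2) / t) := by
  -- With this `s` the exponent is at least `-1` on the ball, so Markov's inequality costs a factor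
  -- `exp 1`.
  set s := 1 / (2 * t) with hs
  have hs0 : 0 < s := by positivity
  have hint : ∫ z, ∏ j, Real.exp (-s * (σ j * z j - a j) ^ 2) ∂(stdNormalPi ι)
      ≤ 1 / √(1 + (∑ j, σ j ^ 2) / t) := by
    rw [integral_fintype_prod_eq_prod (f := fun j x => Real.exp (-s * (σ j * x - a j) ^ 2))]
    calc _ ≤ ∏ j, 1 / √(1 + 2 * s * σ j ^ 2) :=
          Finset.prod_le_prod (fun j _ => integral_nonneg fun x => (Real.exp_pos _).le)
            fun j _ => integral_exp_neg_sq_le s (σ j) (a j) hs0.le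
      _ = 1 / √(∏ j, (1 + 2 * s * σ j ^ 2)) := by
          rw [Finset.prod_div_distrib, Finset.prod_const_one, Real.sqrt_prod]
          intro j _; positivity
      _ ≤ _ := by
          have h0 : 0 ≤ (∑ j, σ j ^ 2) / t := by positivity
          have h1 := one_add_sum_le_prod Finset.univ (fun j => 2 * s * σ j ^ 2)
            (fun j => by positivity)
          rw [← Finset.mul_sum] at h1
          have h2 : 2 * s * ∑ j, σ j ^ 2 = (∑ j, σ j ^ 2) / t := by rw [hs]; field_simp
          rw [h2] at h1
          gcongr
  have hI : Integrable (fun z : ι → ℝ => ∏ j, Real.exp (-s * (σ j * z j - a j) ^ 2))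
      (stdNormalPi ι) := by
    refine Integrable.of_bound (C := 1) (Measurable.aestronglyMeasurable (by fun_prop)) (Filter.Eventually.of_forall fun z => ?_)
    rw [Real.norm_of_nonneg (by positivity), ← Real.exp_sum, Real.exp_le_one_iff]
    refine Finset.sum_nonpos fun j _ => ?_
    have : 0 ≤ s * (σ j * z j - a j) ^ 2 := by positivity
    linarith
  have hM := mul_meas_ge_le_integral_of_nonneg
    (Filter.Eventually.of_forall fun z : ι → ℝ => by positivity) hI (Real.exp (-1))
  have hsub : (stdNormalPi ι).real {z | (∑ j, (σ j * z j - a j) ^ 2) / 2 ≤ t}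
      ≤ (stdNormalPi ι).real
        {z | Real.exp (-1) ≤ ∏ j, Real.exp (-s * (σ j * z j - a j) ^ 2)} := by
    refine measureReal_mono fun z hz => ?_
    simp only [Set.mem_ofPred_eq] at hz ⊢
    rw [← Real.exp_sum, Real.exp_le_exp, ← Finset.mul_sum]
    have : s * ∑ j, (σ j * z j - a j) ^ 2 ≤ s * (2 * t) := by gcongr; linarith
    have h2 : s * (2 * t) = 1 := by rw [hs]; field_simp
    linarith
  have h3 := hM.trans hint
  calc _ ≤ _ := hsub
    _ = Real.exp 1 * (Real.exp (-1) * (stdNormalPi ι).real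
        {z | Real.exp (-1) ≤ ∏ j, Real.exp (-s * (σ j * z j - a j) ^ 2)}) := by
        rw [← mul_assoc, ← Real.exp_add]; simp
    _ ≤ Real.exp 1 * (1 / √(1 + (∑ j, σ j ^ 2) / t)) := by gcongr
    _ = _ := by ring

/-- An upper tail estimate for the squared norm of a centred Gaussian vector with independent
coordinates. -/
theorem stdNormalPi_tail_le (σ : ι → ℝ) {M : ℝ} (hM : 0 < M) (hσ : ∀ j, σ j ^ 2 ≤ M) (τ : ℝ) :
    (stdNormalPi ι).real {z | 2 * ∑ j, σ j ^ 2 + 2 * τ < (∑ j, (σ j * z j) ^ 2) / 2}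
      ≤ Real.exp (-τ / M) := by
  -- The largest `s` for which `integral_exp_sq_le` applies to every coordinate. The Chernoff
  -- exponent is then `-2s ∑ σ j² - 4sτ ≤ -τ/M`.
  set s := 1 / (4 * M) with hs
  have hs0 : 0 < s := by positivity
  have hsM : s * M = 1 / 4 := by rw [hs]; field_simp
  have hb : ∀ j, 2 * s * σ j ^ 2 ≤ 1 / 2 := fun j => by
    have : s * σ j ^ 2 ≤ s * M := by gcongr; exact hσ j
    linarith
  have hint : ∫ z, ∏ j, Real.exp (s * (σ j * z j) ^ 2) ∂(stdNormalPi ι)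
      ≤ Real.exp (2 * s * ∑ j, σ j ^ 2) := by
    rw [integral_fintype_prod_eq_prod (f := fun j x => Real.exp (s * (σ j * x) ^ 2)),
      Finset.mul_sum, Real.exp_sum]
    exact Finset.prod_le_prod (fun j _ => integral_nonneg fun x => (Real.exp_pos _).le)
            fun j _ => (integral_exp_sq_le s (σ j) hs0.le (hb j)).2
  have hI : Integrable (fun z : ι → ℝ => ∏ j, Real.exp (s * (σ j * z j) ^ 2))
      (stdNormalPi ι) :=
    Integrable.fintype_prod_dep (f := fun j x => Real.exp (s * (σ j * x) ^ 2))
      fun j => (integral_exp_sq_le s (σ j) hs0.le (hb j)).1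
  set T := s * (4 * ∑ j, σ j ^ 2 + 4 * τ) with hT
  have hMk := mul_meas_ge_le_integral_of_nonneg
    (Filter.Eventually.of_forall fun z : ι → ℝ => by positivity) hI (Real.exp T)
  have hsub : (stdNormalPi ι).real {z | 2 * ∑ j, σ j ^ 2 + 2 * τ < (∑ j, (σ j * z j) ^ 2) / 2}
      ≤ (stdNormalPi ι).real {z | Real.exp T ≤ ∏ j, Real.exp (s * (σ j * z j) ^ 2)} := by
    refine measureReal_mono fun z hz => ?_
    simp only [Set.mem_ofPred_eq] at hz ⊢
    rw [← Real.exp_sum, Real.exp_le_exp, ← Finset.mul_sum]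
    exact mul_le_mul_of_nonneg_left (by linarith) hs0.le
  have h3 := hMk.trans hint
  calc _ ≤ _ := hsub
    _ = Real.exp (-T) * (Real.exp T * (stdNormalPi ι).real
        {z | Real.exp T ≤ ∏ j, Real.exp (s * (σ j * z j) ^ 2)}) := by
        rw [← mul_assoc, ← Real.exp_add]; simp
    _ ≤ Real.exp (-T) * Real.exp (2 * s * ∑ j, σ j ^ 2) := by gcongr
    _ ≤ _ := by
        rw [← Real.exp_add]
        apply Real.exp_le_exp.mpr
        have h4 : 0 ≤ s * ∑ j, σ j ^ 2 := by positivity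
        have h5 : -τ / M = -(4 * (s * τ)) := by rw [hs]; field_simp
        rw [h5, hT]
        linarith

/-! #### Anti-concentration of a single Gaussian variable -/

theorem stdNormal_Ioo_ge {s : ℝ} (hs : 0 ≤ s) :
    (√(2 * Real.pi))⁻¹ * Real.exp (-(s + 1) ^ 2 / 2) ≤ (gaussianReal 0 1).real (Set.Ioo s (s + 1)) := by
  rw [measureReal_def, gaussianReal_apply_eq_integral _ one_ne_zero,
    ENNReal.toReal_ofReal (integral_nonneg fun x => gaussianPDFReal_nonneg 0 1 x)]
  have h : ∫ x in Set.Ioo s (s + 1), (√(2 * Real.pi))⁻¹ * Real.exp (-(s + 1) ^ 2 / 2)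
      ≤ ∫ x in Set.Ioo s (s + 1), gaussianPDFReal 0 1 x := by
    refine setIntegral_mono_on (integrableOn_const (by simp)) (integrable_gaussianPDFReal 0 1).integrableOn
      measurableSet_Ioo fun x hx => ?_
    simp only [gaussianPDFReal, NNReal.coe_one, mul_one, sub_zero]
    have h1 : x ^ 2 ≤ (s + 1) ^ 2 := by nlinarith [hx.1, hx.2]
    gcongr
  simpa using h

theorem stdNormal_Icc_le {a b : ℝ} (hab : a ≤ b) :
    (gaussianReal 0 1).real (Set.Icc a b) ≤ (b - a) / 2 := by
  rw [measureReal_def, gaussianReal_apply_eq_integral _ one_ne_zero,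
    ENNReal.toReal_ofReal (integral_nonneg fun x => gaussianPDFReal_nonneg 0 1 x)]
  have h : ∫ x in Set.Icc a b, gaussianPDFReal 0 1 x ≤ ∫ x in Set.Icc a b, (1 / 2 : ℝ) := by
    refine setIntegral_mono_on (integrable_gaussianPDFReal 0 1).integrableOn (by simp)
      measurableSet_Icc fun x hx => ?_
    simp only [gaussianPDFReal, NNReal.coe_one, mul_one, sub_zero]
    have h1 : (√(2 * Real.pi))⁻¹ ≤ 1 / 2 := by
      rw [one_div]
      gcongr
      apply Real.le_sqrt_of_sq_le
      nlinarith [Real.pi_gt_three]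
    have h2 : Real.exp (-x ^ 2 / 2) ≤ 1 := by
      rw [Real.exp_le_one_iff]; nlinarith [sq_nonneg x]
    calc _ ≤ 1 / 2 * (1 : ℝ) := by gcongr
      _ = _ := by ring
  refine h.trans (le_of_eq ?_)
  simp [hab]
  ring

/-- Here `s + 1 ≤ 3s`, which is the origin of the `9/2`; the factor `1/4` is a lower bound for
`1/√(2π)`. -/
theorem stdNormal_Ioo_ge_exp {s : ℝ} (hs : 1 / 2 ≤ s) :
    1 / 4 * Real.exp (-(9 / 2 * s ^ 2)) ≤ (gaussianReal 0 1).real (Set.Ioo s (s + 1)) := by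
  refine le_trans ?_ (stdNormal_Ioo_ge (by linarith))
  have h1 : (1 / 4 : ℝ) ≤ (√(2 * Real.pi))⁻¹ := by
    rw [one_div]
    have hp := Real.pi_pos
    gcongr
    rw [Real.sqrt_le_left (by norm_num)]
    nlinarith [Real.pi_le_four]
  have h2 : Real.exp (-(9 / 2 * s ^ 2)) ≤ Real.exp (-(s + 1) ^ 2 / 2) := by
    apply Real.exp_le_exp.mpr
    nlinarith
  gcongr

/-- The probability that a Gaussian variable is within `s` of some point is bounded away from one. -/
theorem stdNormal_Icc_sub_le {s : ℝ} (hs : 0 ≤ s) (a : ℝ) :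
    (gaussianReal 0 1).real (Set.Icc (a - s) (a + s)) ≤ 1 - 1 / 4 * Real.exp (-(9 / 2 * s ^ 2)) := by
  -- A short interval has mass at most `s ≤ 1/2`, below `3/4`. A long one misses a unit interval
  -- adjacent to `[-s, s]`: the right one if `a ≤ 0`, the left one if `a ≥ 0`.
  by_cases h : s ≤ 1 / 2
  · have h1 := stdNormal_Icc_le (show a - s ≤ a + s by linarith)
    have h2 : Real.exp (-(9 / 2 * s ^ 2)) ≤ 1 := by
      rw [Real.exp_le_one_iff]; nlinarith [sq_nonneg s]
    linarith
  · push Not at h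
    have hneg : (gaussianReal 0 1).real (Set.Ioo (-(s + 1)) (-s))
        = (gaussianReal 0 1).real (Set.Ioo s (s + 1)) := by
      have := gaussianReal_map_neg (μ := 0) (v := 1)
      rw [neg_zero] at this
      conv_lhs => rw [← this]
      rw [map_measureReal_apply (by fun_prop) measurableSet_Ioo]
      congr 1
      ext x
      simp only [Set.mem_preimage, Set.mem_Ioo]
      constructor <;> rintro ⟨h1, h2⟩ <;> constructor <;> linarith
    have h0 := stdNormal_Ioo_ge_exp h.le
    have key : ∀ B : Set ℝ, B ⊆ (Set.Icc (a - s) (a + s))ᶜ →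
        1 / 4 * Real.exp (-(9 / 2 * s ^ 2)) ≤ (gaussianReal 0 1).real B →
        (gaussianReal 0 1).real (Set.Icc (a - s) (a + s))
          ≤ 1 - 1 / 4 * Real.exp (-(9 / 2 * s ^ 2)) := by
      intro B hB hle
      have h1 := measureReal_mono (μ := gaussianReal 0 1) hB
      rw [probReal_compl_eq_one_sub measurableSet_Icc] at h1
      linarith
    rcases le_total a 0 with ha | ha
    · refine key _ (fun x hx => ?_) h0
      simp only [Set.mem_compl_iff, Set.mem_Icc, not_and, not_le]
      intro _; linarith [hx.1]
    · refine key _ (fun x hx => ?_) (h0.trans_eq hneg.symm)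
      simp only [Set.mem_compl_iff, Set.mem_Icc, not_and, not_le]
      intro h3; linarith [hx.2]

/-- Anti-concentration of a Gaussian vector with independent coordinates, in terms of a single
coordinate. -/
theorem stdNormalPi_ball_le (σ a : ι → ℝ) (k : ι) (hσ : 0 < σ k) {t : ℝ} (ht : 0 ≤ t) :
    (stdNormalPi ι).real {z | (∑ j, (σ j * z j - a j) ^ 2) / 2 ≤ t}
      ≤ 1 - 1 / 4 * Real.exp (-(9 * t / σ k ^ 2)) := by
  -- The ball lies in the slab where coordinate `k` alone has squared error at most `2t`, an
  -- interval of half-width `s` in `z k`.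
  set s := √(2 * t) / σ k with hs
  have hs2 : s ^ 2 = 2 * t / σ k ^ 2 := by
    rw [hs, div_pow, Real.sq_sqrt (by positivity)]
  have h1 : (stdNormalPi ι).real {z | (∑ j, (σ j * z j - a j) ^ 2) / 2 ≤ t}
      ≤ (stdNormalPi ι).real ((fun z => z k) ⁻¹' Set.Icc (a k / σ k - s) (a k / σ k + s)) := by
    refine measureReal_mono fun z hz => ?_
    simp only [Set.mem_ofPred_eq] at hz
    have h2 : (σ k * z k - a k) ^ 2 ≤ 2 * t :=
      (Finset.single_le_sum (f := fun j => (σ j * z j - a j) ^ 2) (fun j _ => sq_nonneg _)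
        (Finset.mem_univ k)).trans (by linarith)
    have h3 : (z k - a k / σ k) ^ 2 ≤ s ^ 2 := by
      rw [hs2, le_div_iff₀ (by positivity)]
      calc _ = (σ k * z k - a k) ^ 2 := by field_simp
        _ ≤ _ := h2
    have h4 := abs_le_of_sq_le_sq' h3 (by positivity)
    simp only [Set.mem_preimage, Set.mem_Icc]
    constructor <;> linarith [h4.1, h4.2]
  have h5 : (stdNormalPi ι).real ((fun z => z k) ⁻¹' Set.Icc (a k / σ k - s) (a k / σ k + s))
      = (gaussianReal 0 1).real (Set.Icc (a k / σ k - s) (a k / σ k + s)) :=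
    (measurePreserving_eval (fun _ : ι => gaussianReal 0 1) k).measureReal_preimage
      measurableSet_Icc.nullMeasurableSet
  rw [h5] at h1
  refine (h1.trans (stdNormal_Icc_sub_le (by positivity) _)).trans_eq ?_
  rw [hs2]
  congr 4
  ring

/-! ### Linear images of standard Gaussian vectors -/

section LinearImages

variable {ι κ κ' : Type*} [Fintype ι]

theorem memLp_eval_stdNormalPi (i : ι) : MemLp (fun g : ι → ℝ => g i) 2 (stdNormalPi ι) :=
  (memLp_id_gaussianReal' (μ := 0) (v := 1) 2 (by simp)).comp_measurePreserving
    (measurePreserving_eval (fun _ : ι => gaussianReal 0 1) i)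

theorem hasGaussianLaw_id_stdNormalPi :
    HasGaussianLaw (fun g : ι → ℝ => g) (stdNormalPi ι) := by
  refine iIndepFun.hasGaussianLaw (X := fun i (g : ι → ℝ) => g i) (fun i => ?_) ?_
  · have h := (measurePreserving_eval (fun _ : ι => gaussianReal 0 1) i).map_eq
    refine ⟨?_⟩
    change IsGaussian ((stdNormalPi ι).map (Function.eval i))
    rw [h]
    infer_instance
  · exact iIndepFun_pi (X := fun _ : ι => (id : ℝ → ℝ)) fun i => aemeasurable_id

theorem covariance_eval_stdNormalPi [DecidableEq ι] (i j : ι) :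
    cov[fun g : ι → ℝ => g i, fun g => g j; stdNormalPi ι] = if i = j then 1 else 0 := by
  split_ifs with h
  · subst h
    rw [covariance_self (measurable_pi_apply i).aemeasurable]
    have h1 := (measurePreserving_eval (fun _ : ι => gaussianReal 0 1) i)
    have h2 := variance_id_gaussianReal (μ := 0) (v := 1)
    rw [← h1.map_eq, variance_map (by fun_prop) h1.measurable.aemeasurable] at h2
    simpa using h2
  · have hI : iIndepFun (fun i (g : ι → ℝ) => g i) (stdNormalPi ι) :=
      iIndepFun_pi (X := fun _ : ι => (id : ℝ → ℝ)) fun i => aemeasurable_id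
    exact (hI.indepFun h).covariance_eq_zero (memLp_eval_stdNormalPi i) (memLp_eval_stdNormalPi j)

theorem covariance_dotProduct_stdNormalPi (a b : ι → ℝ) :
    cov[fun g => a ⬝ᵥ g, fun g => b ⬝ᵥ g; stdNormalPi ι] = a ⬝ᵥ b := by
  classical
  simp only [dotProduct]
  rw [covariance_fun_sum_fun_sum (X := fun i (g : ι → ℝ) => a i * g i)
    (Y := fun i (g : ι → ℝ) => b i * g i) (fun i => (memLp_eval_stdNormalPi i).const_mul _)
    (fun i => (memLp_eval_stdNormalPi i).const_mul _)]
  simp_rw [covariance_const_mul_left, covariance_const_mul_right, covariance_eval_stdNormalPi]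
  simp

theorem integral_dotProduct_stdNormalPi (a : ι → ℝ) :
    ∫ g, a ⬝ᵥ g ∂(stdNormalPi ι) = 0 := by
  simp only [dotProduct]
  rw [integral_finsetSum _ fun i _ =>
    ((memLp_eval_stdNormalPi i).integrable one_le_two).const_mul _]
  refine Finset.sum_eq_zero fun i _ => ?_
  rw [integral_const_mul,
    integral_comp_eval (μ := fun _ : ι => gaussianReal 0 1) (f := fun x : ℝ => x) (by fun_prop)]
  simp

/-- A family of linear forms, as a continuous linear map. -/
noncomputable def linearForms (C : κ → ι → ℝ) : (ι → ℝ) →L[ℝ] (κ → ℝ) :=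
  LinearMap.toContinuousLinearMap (Matrix.mulVecLin (Matrix.of C))

theorem linearForms_apply (C : κ → ι → ℝ) (g : ι → ℝ) (k : κ) :
    linearForms C g k = C k ⬝ᵥ g := rfl

variable [Fintype κ] [Fintype κ']

/-- Linear forms with orthonormal coefficients preserve the standard Gaussian measure. -/
theorem measurePreserving_linearForms [DecidableEq κ] (O : κ → ι → ℝ)
    (hO : ∀ k l, O k ⬝ᵥ O l = if k = l then 1 else 0) :
    MeasurePreserving (linearForms O) (stdNormalPi ι) (stdNormalPi κ) := by
  refine ⟨by fun_prop, ?_⟩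
  have hG : HasGaussianLaw (fun g k => linearForms O g k) (stdNormalPi ι) :=
    hasGaussianLaw_id_stdNormalPi.map_fun (linearForms O)
  have hI : iIndepFun (fun k g => linearForms O g k) (stdNormalPi ι) := by
    refine hG.iIndepFun_of_covariance_eq_zero fun k l hkl => ?_
    simp_rw [linearForms_apply]
    rw [covariance_dotProduct_stdNormalPi, hO, if_neg hkl]
  have h1 := (iIndepFun_iff_map_fun_eq_pi_map (fun k => by fun_prop)).1 hI
  refine h1.trans ?_
  congr 1
  funext k
  rw [(hG.eval k).map_eq_gaussianReal]
  have h2 : ∫ g, linearForms O g k ∂(stdNormalPi ι) = 0 := integral_dotProduct_stdNormalPi (O k)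
  have h3 : Var[fun g => linearForms O g k; stdNormalPi ι] = 1 := by
    rw [← covariance_self (by fun_prop)]
    simp_rw [linearForms_apply]
    rw [covariance_dotProduct_stdNormalPi, hO, if_pos rfl]
  rw [h2, h3, Real.toNNReal_one]

/-- Families of linear forms with mutually orthogonal coefficients are independent. -/
theorem indepFun_linearForms (C : κ → ι → ℝ) (D : κ' → ι → ℝ) (h : ∀ k l, C k ⬝ᵥ D l = 0) :
    IndepFun (linearForms C) (linearForms D) (stdNormalPi ι) := by
  refine HasGaussianLaw.indepFun_of_covariance_eval (X := fun k g => linearForms C g k)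
    (Y := fun k g => linearForms D g k) ?_ fun k l => ?_
  · exact hasGaussianLaw_id_stdNormalPi.map_fun ((linearForms C).prod (linearForms D))
  · simp_rw [linearForms_apply]
    rw [covariance_dotProduct_stdNormalPi, h]

end LinearImages

/-! ### The posterior in a Gaussian sequence model -/

theorem prod_measure_le_of_forall {α β : Type*} [MeasurableSpace α] [MeasurableSpace β]
    (μ : Measure α) (ν : Measure β) [SFinite μ] [IsProbabilityMeasure ν] {S : Set (α × β)}
    (hS : MeasurableSet S) {B : ℝ≥0∞} (h : ∀ y, μ ((fun x => (x, y)) ⁻¹' S) ≤ B) :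
    (μ.prod ν) S ≤ B := by
  rw [Measure.prod_apply_symm hS]
  calc _ ≤ ∫⁻ _, B ∂ν := lintegral_mono h
    _ = B := by simp

/-- In the model `yᵢ = ∑ⱼ aᵢⱼ T gⱼ + ν hᵢ` with `g`, `h` standard Gaussian and orthogonal design,
the error of any estimator of `T g` based on `y` is at least as spread out as the posterior, whose
coordinates are independent with standard deviations `ν / √(ℓⱼ + ν² / T²)`. -/
theorem bayes_ball_le {d n : ℕ} (a : Fin n → Fin d → ℝ) (ℓ : Fin d → ℝ) (hℓ : ∀ j, 0 ≤ ℓ j)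
    (ha : ∀ j k, ∑ i, a i j * a i k = if j = k then ℓ j else 0) {T ν : ℝ} (hT : 0 < T)
    (hν : 0 < ν) (f : (Fin n → ℝ) → Fin d → ℝ) (hf : Measurable f) (t : ℝ) {B : ℝ≥0∞}
    (hB : ∀ c : Fin d → ℝ, stdNormalPi (Fin d)
      {z | (∑ j, (ν / √(ℓ j + ν ^ 2 / T ^ 2) * z j - c j) ^ 2) / 2 ≤ t} ≤ B) :
    ((stdNormalPi (Fin d)).prod (stdNormalPi (Fin n)))
      {p | (∑ j, (f (fun i => ∑ k, a i k * (T * p.1 k) + ν * p.2 i) j - T * p.1 j) ^ 2) / 2 ≤ t}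
      ≤ B := by
  set m : Fin d → ℝ := fun j => ℓ j + ν ^ 2 / T ^ 2 with hm
  have hm0 : ∀ j, 0 < m j := fun j => by have := hℓ j; simp only [hm]; positivity
  have hms0 : ∀ j, 0 < √(m j) := fun j => Real.sqrt_pos.mpr (hm0 j)
  -- On the joint space of `(g, h)`, `D` yields the observation `y` and `O` the standardized
  -- residual of `T g` about its posterior mean `(∑ i, a i j * y i) / m j`. Orthonormality of `O`
  -- makes the residual standard normal; orthogonality to `D` makes it independent of `y`.
  let O : Fin d → Fin d ⊕ Fin n → ℝ := fun j =>
    Sum.elim (fun k => if j = k then ν / (T * √(m j)) else 0) (fun i => -a i j / √(m j))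
  let D : Fin n → Fin d ⊕ Fin n → ℝ := fun i =>
    Sum.elim (fun k => T * a i k) (fun i' => if i = i' then ν else 0)
  have hO : ∀ j k, O j ⬝ᵥ O k = if j = k then 1 else 0 := by
    intro j k
    have h2 : ∑ i, -a i j / √(m j) * (-a i k / √(m k))
        = (∑ i, a i j * a i k) / (√(m j) * √(m k)) := by
      rw [Finset.sum_div]
      refine Finset.sum_congr rfl fun i _ => ?_
      have := hms0 j; have := hms0 k
      field_simp
    simp only [O, dotProduct, Fintype.sum_sum_type, Sum.elim_inl, Sum.elim_inr]
    rw [h2, ha]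
    by_cases h : j = k
    · subst h
      simp only [ite_mul, zero_mul, Finset.sum_ite_eq, Finset.mem_univ, if_true]
      have := hms0 j
      have h4 : √(m j) * √(m j) = m j := Real.mul_self_sqrt (hm0 j).le
      rw [h4]
      have h5 : ν / (T * √(m j)) * (ν / (T * √(m j))) = (ν ^ 2 / T ^ 2) / (√(m j) * √(m j)) := by
        field_simp
      rw [h5, h4, ← add_div, div_eq_one_iff_eq (hm0 j).ne']
      simp only [hm]; ring
    · simp [h]
  have hOD : ∀ j i, O j ⬝ᵥ D i = 0 := by
    intro j i
    simp only [O, D, dotProduct, Fintype.sum_sum_type, Sum.elim_inl, Sum.elim_inr, ite_mul,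
      zero_mul, Finset.sum_ite_eq, Finset.mem_univ, if_true, mul_ite, mul_zero]
    have := hms0 j
    field_simp
    ring
  have hmp := measurePreserving_linearForms O hO
  have hind := indepFun_linearForms O D hOD
  rw [indepFun_iff_map_prod_eq_prod_map_map (by fun_prop) (by fun_prop), hmp.map_eq] at hind
  have hsum := (measurePreserving_sumPiEquivProdPi (fun _ : Fin d ⊕ Fin n => gaussianReal 0 1))
  set e := MeasurableEquiv.sumPiEquivProdPi (fun _ : Fin d ⊕ Fin n => ℝ) with he
  have heq : ((stdNormalPi (Fin d)).prod (stdNormalPi (Fin n)))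
      {p | (∑ j, (f (fun i => ∑ k, a i k * (T * p.1 k) + ν * p.2 i) j - T * p.1 j) ^ 2) / 2 ≤ t}
      = stdNormalPi (Fin d ⊕ Fin n) (e ⁻¹' {p | (∑ j, (f (fun i => ∑ k, a i k * (T * p.1 k)
        + ν * p.2 i) j - T * p.1 j) ^ 2) / 2 ≤ t}) := by
    rw [hsum.measure_preimage]
    refine MeasurableSet.nullMeasurableSet (measurableSet_le ?_ measurable_const)
    have h1 : Measurable fun p : (Fin d → ℝ) × (Fin n → ℝ) =>
        f (fun i => ∑ k, a i k * (T * p.1 k) + ν * p.2 i) := hf.comp (by fun_prop)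
    fun_prop
  rw [heq]
  -- Once `y` is fixed, the estimate minus the posterior mean is a constant, so the error event is a
  -- ball for the residual with centre `c y`.
  set c : (Fin n → ℝ) → Fin d → ℝ := fun y j => f y j - (∑ i, a i j * y i) / m j with hc
  have hcm : Measurable c := by fun_prop
  set S : Set ((Fin d → ℝ) × (Fin n → ℝ)) :=
    {p | (∑ j, (ν / √(m j) * p.1 j - c p.2 j) ^ 2) / 2 ≤ t} with hS
  have hSm : MeasurableSet S := by
    refine measurableSet_le ?_ measurable_const
    fun_prop
  have hpre : e ⁻¹' {p | (∑ j, (f (fun i => ∑ k, a i k * (T * p.1 k)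
        + ν * p.2 i) j - T * p.1 j) ^ 2) / 2 ≤ t}
      = (fun g => (linearForms O g, linearForms D g)) ⁻¹' S := by
    ext g
    have hy : (fun i => ∑ k, a i k * (T * (e g).1 k) + ν * (e g).2 i) = linearForms D g := by
      funext i
      rw [linearForms_apply]
      simp only [D, dotProduct, Fintype.sum_sum_type, Sum.elim_inl, Sum.elim_inr, ite_mul,
        zero_mul, Finset.sum_ite_eq, Finset.mem_univ, if_true]
      congr 1
      refine Finset.sum_congr rfl fun k _ => ?_
      simp only [he, MeasurableEquiv.coe_sumPiEquivProdPi, Equiv.sumPiEquivProdPi]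
      simp only [Equiv.coe_fn_mk]
      ring
    have hz : ∀ j, T * (e g).1 j
        = ν / √(m j) * linearForms O g j + (∑ i, a i j * linearForms D g i) / m j := by
      intro j
      rw [← hy]
      have e1 : ∑ i, a i j * (∑ k, a i k * (T * (e g).1 k) + ν * (e g).2 i)
          = ℓ j * (T * (e g).1 j) + ν * ∑ i, a i j * (e g).2 i := by
        simp_rw [mul_add, Finset.sum_add_distrib, Finset.mul_sum]
        rw [Finset.sum_comm]
        congr 1
        · simp_rw [← mul_assoc, ← Finset.sum_mul, ha]
          simp
        · exact Finset.sum_congr rfl fun i _ => by ring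
      rw [e1, linearForms_apply]
      simp only [O, dotProduct, Fintype.sum_sum_type, Sum.elim_inl, Sum.elim_inr, ite_mul,
        zero_mul, Finset.sum_ite_eq, Finset.mem_univ, if_true]
      have e2 : ∑ i, -a i j / √(m j) * g (Sum.inr i) = -(∑ i, a i j * (e g).2 i) / √(m j) := by
        rw [← Finset.sum_neg_distrib, Finset.sum_div]
        refine Finset.sum_congr rfl fun i _ => ?_
        change _ = -(a i j * g (Sum.inr i)) / _
        ring
      rw [e2]
      change T * g (Sum.inl j) = ν / √(m j) * (ν / (T * √(m j)) * g (Sum.inl j) + _)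
        + (ℓ j * (T * g (Sum.inl j)) + _) / m j
      set q := ∑ i, a i j * (e g).2 i
      have h4 : √(m j) * √(m j) = m j := Real.mul_self_sqrt (hm0 j).le
      have h6 := hms0 j
      have h7 := hm0 j
      have e3 : ν / √(m j) * (ν / (T * √(m j)) * g (Sum.inl j) + -q / √(m j))
          = (ν ^ 2 / T * g (Sum.inl j) - ν * q) / (√(m j) * √(m j)) := by
        field_simp
        ring
      rw [e3, h4, ← add_div, eq_div_iff h7.ne']
      have : m j = ℓ j + ν ^ 2 / T ^ 2 := rfl
      rw [this]
      field_simp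
      ring
    simp only [Set.mem_preimage, hS, Set.mem_ofPred_eq]
    rw [hy]
    have : ∀ j, (f (linearForms D g) j - T * (e g).1 j) ^ 2
        = (ν / √(m j) * linearForms O g j - c (linearForms D g) j) ^ 2 := by
      intro j
      rw [hz j, hc]
      ring
    simp_rw [this]
  rw [hpre, ← Measure.map_apply (by fun_prop) hSm, hind]
  have : IsProbabilityMeasure ((stdNormalPi (Fin d ⊕ Fin n)).map (linearForms D)) :=
    Measure.isProbabilityMeasure_map (by fun_prop)
  exact prod_measure_le_of_forall _ _ hSm fun y => hB (c y)

/-! ### Covariance matrices as operators -/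

section Operators

variable {d n : ℕ}

/-- The operator on Euclidean space given by a matrix. -/
noncomputable abbrev euclOp (A : Matrix (Fin d) (Fin d) ℝ) :
    EuclideanSpace ℝ (Fin d) →L[ℝ] EuclideanSpace ℝ (Fin d) :=
  Matrix.toEuclideanCLM (𝕜 := ℝ) A

theorem euclOp_mul_apply (A B : Matrix (Fin d) (Fin d) ℝ) (x : EuclideanSpace ℝ (Fin d)) :
    euclOp (A * B) x = euclOp A (euclOp B x) := by
  simp [euclOp, map_mul]

theorem euclOp_one_apply (x : EuclideanSpace ℝ (Fin d)) :
    euclOp (1 : Matrix (Fin d) (Fin d) ℝ) x = x := by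
  simp [euclOp]

theorem inner_eq_dotProduct (x y : EuclideanSpace ℝ (Fin d)) :
    ⟪x, y⟫ = (x : Fin d → ℝ) ⬝ᵥ (y : Fin d → ℝ) := by
  simp [PiLp.inner_apply, dotProduct, mul_comm]

theorem inner_euclOp_comm {A : Matrix (Fin d) (Fin d) ℝ} (hA : A.IsHermitian)
    (x y : EuclideanSpace ℝ (Fin d)) : ⟪euclOp A x, y⟫ = ⟪x, euclOp A y⟫ := by
  rw [inner_eq_dotProduct, inner_eq_dotProduct, Matrix.ofLp_toEuclideanCLM,
    Matrix.ofLp_toEuclideanCLM, Matrix.dotProduct_mulVec, ← Matrix.mulVec_transpose]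
  congr 1
  have : A.transpose = A := by simpa [Matrix.IsHermitian] using hA
  rw [this]

theorem trace_eq_sum_inner_euclOp (A : Matrix (Fin d) (Fin d) ℝ)
    (b : OrthonormalBasis (Fin d) ℝ (EuclideanSpace ℝ (Fin d))) :
    A.trace = ∑ j, ⟪b j, euclOp A (b j)⟫ := by
  have h := LinearMap.trace_eq_sum_inner (𝕜 := ℝ) (euclOp A).toLinearMap b
  rw [LinearMap.trace_eq_sum_inner (𝕜 := ℝ) (euclOp A).toLinearMap
    (EuclideanSpace.basisFun (Fin d) ℝ)] at h
  refine Eq.trans ?_ h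
  rw [Matrix.trace]
  refine Finset.sum_congr rfl fun i _ => ?_
  simp [inner_eq_dotProduct]

theorem rank_lt_iff_not_isUnit (A : Matrix (Fin d) (Fin d) ℝ) : A.rank < d ↔ ¬ IsUnit A := by
  constructor
  · intro h hA
    rw [Matrix.rank_of_isUnit A hA, Fintype.card_fin] at h
    exact lt_irrefl _ h
  · intro h
    refine lt_of_le_of_ne (by simpa using Matrix.rank_le_card_width A) fun he => h ?_
    rw [← Matrix.linearIndependent_rows_iff_isUnit, linearIndependent_iff_card_eq_finrank_span,
      Fintype.card_fin]
    exact he.symm.trans (Matrix.rank_eq_finrank_span_row A)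

theorem inner_euclOp_sampleCov (x : Fin n → EuclideanSpace ℝ (Fin d))
    (u w : EuclideanSpace ℝ (Fin d)) :
    ⟪u, euclOp (sampleCov x) w⟫ = (n : ℝ)⁻¹ * ∑ i, ⟪u, x i⟫ * ⟪x i, w⟫ := by
  simp only [inner_eq_dotProduct, Matrix.ofLp_toEuclideanCLM, dotProduct, Matrix.mulVec, sampleCov,
    Matrix.of_apply]
  simp_rw [Finset.sum_mul_sum, Finset.mul_sum, Finset.sum_mul, Finset.mul_sum]
  conv_rhs => rw [Finset.sum_comm]
  refine Finset.sum_congr rfl fun a _ => ?_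
  rw [Finset.sum_comm]
  refine Finset.sum_congr rfl fun i _ => Finset.sum_congr rfl fun b _ => ?_
  ring

variable {PX : Measure (EuclideanSpace ℝ (Fin d))}

theorem memLp_inner (hmom : MemLp id 2 PX) (u : EuclideanSpace ℝ (Fin d)) :
    MemLp (fun x => ⟪u, x⟫) 2 PX :=
  hmom.const_inner u

theorem memLp_coord (hmom : MemLp id 2 PX) (a : Fin d) :
    MemLp (fun x : EuclideanSpace ℝ (Fin d) => x a) 2 PX := by
  simpa [EuclideanSpace.inner_single_left] using memLp_inner hmom (EuclideanSpace.single a (1 : ℝ))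

theorem inner_euclOp_covMatrix (hmom : MemLp id 2 PX) (u : EuclideanSpace ℝ (Fin d)) :
    ⟪u, euclOp (covMatrix PX) u⟫ = ∫ x, ⟪u, x⟫ ^ 2 ∂PX := by
  have hint : ∀ a b : Fin d, Integrable (fun x : EuclideanSpace ℝ (Fin d) => x a * x b) PX :=
    fun a b => (memLp_coord hmom a).integrable_mul (memLp_coord hmom b)
  have e : ∀ x : EuclideanSpace ℝ (Fin d), ⟪u, x⟫ ^ 2 = ∑ a, ∑ b, (u a * u b) * (x a * x b) := by
    intro x
    rw [inner_eq_dotProduct, dotProduct, sq, Finset.sum_mul_sum]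
    exact Finset.sum_congr rfl fun a _ => Finset.sum_congr rfl fun b _ => by ring
  simp_rw [e]
  rw [integral_finsetSum _ fun a _ => integrable_finsetSum _ fun b _ => (hint a b).const_mul _]
  simp_rw [integral_finsetSum _ fun b _ => (hint _ b).const_mul _, integral_const_mul]
  simp only [inner_eq_dotProduct, Matrix.ofLp_toEuclideanCLM, dotProduct, Matrix.mulVec, covMatrix,
    Matrix.of_apply, Finset.mul_sum]
  exact Finset.sum_congr rfl fun a _ => Finset.sum_congr rfl fun b _ => by ring

theorem isHermitian_covMatrix : (covMatrix PX).IsHermitian := by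
  ext a b
  simp [covMatrix, mul_comm]

/-- A vanishing second moment of `⟪w, X⟫` would force `⟪w, X⟫ = 0` almost surely, which
nondegeneracy excludes. -/
theorem posDef_covMatrix [IsProbabilityMeasure PX] (hmom : MemLp id 2 PX)
    (hsupp : ∀ w : EuclideanSpace ℝ (Fin d), w ≠ 0 → PX {x | ⟪w, x⟫ = 0} < 1) :
    (covMatrix PX).PosDef := by
  rw [Matrix.posDef_iff_dotProduct_mulVec]
  refine ⟨isHermitian_covMatrix, fun u hu => ?_⟩
  set w : EuclideanSpace ℝ (Fin d) := WithLp.toLp 2 u with hw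
  have hw0 : w ≠ 0 := by
    intro h
    apply hu
    have := congrArg WithLp.ofLp h
    simpa [hw] using this
  have h1 := inner_euclOp_covMatrix hmom w
  rw [inner_eq_dotProduct, Matrix.ofLp_toEuclideanCLM] at h1
  have h2 : 0 ≤ ∫ x, ⟪w, x⟫ ^ 2 ∂PX := integral_nonneg fun x => sq_nonneg _
  have h3 : ∫ x, ⟪w, x⟫ ^ 2 ∂PX ≠ 0 := by
    intro h
    rw [integral_eq_zero_iff_of_nonneg (fun x => sq_nonneg _) (memLp_inner hmom w).integrable_sq] at h
    have h4 : ∀ᵐ x ∂PX, ⟪w, x⟫ = 0 := by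
      filter_upwards [h] with x hx
      simpa using hx
    have h5 := hsupp w hw0
    rw [prob_compl_eq_zero_iff₀ (s := {x | ⟪w, x⟫ = 0}) ?_ |>.1 h4] at h5
    · exact lt_irrefl _ h5
    · exact (isClosed_eq (by fun_prop) continuous_const).measurableSet.nullMeasurableSet
  have h4 : 0 < ∫ x, ⟪w, x⟫ ^ 2 ∂PX := lt_of_le_of_ne h2 h3.symm
  rw [← h1] at h4
  simpa [hw] using h4

open scoped MatrixOrder in
/-- The square root of the covariance matrix. -/
noncomputable def sqrtCov (PX : Measure (EuclideanSpace ℝ (Fin d))) : Matrix (Fin d) (Fin d) ℝ :=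
  CFC.sqrt (covMatrix PX)

open scoped MatrixOrder in
theorem isHermitian_sqrtCov : (sqrtCov PX).IsHermitian :=
  (Matrix.nonneg_iff_posSemidef.mp (CFC.sqrt_nonneg _)).1

open scoped MatrixOrder in
theorem sqrtCov_mul_self (hcov : (covMatrix PX).PosDef) :
    sqrtCov PX * sqrtCov PX = covMatrix PX :=
  CFC.sqrt_mul_sqrt_self _ (Matrix.nonneg_iff_posSemidef.mpr hcov.posSemidef)

theorem isUnit_det_sqrtCov (hcov : (covMatrix PX).PosDef) : IsUnit (sqrtCov PX).det := by
  have h := hcov.det_pos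
  rw [← sqrtCov_mul_self hcov, Matrix.det_mul] at h
  exact isUnit_iff_ne_zero.2 fun h0 => by simp [h0] at h

theorem invSqrt_mul_sqrtCov (hcov : (covMatrix PX).PosDef) :
    invSqrt (covMatrix PX) * sqrtCov PX = 1 :=
  Matrix.nonsing_inv_mul _ (isUnit_det_sqrtCov hcov)

theorem sqrtCov_mul_invSqrt (hcov : (covMatrix PX).PosDef) :
    sqrtCov PX * invSqrt (covMatrix PX) = 1 :=
  Matrix.mul_nonsing_inv _ (isUnit_det_sqrtCov hcov)

theorem isUnit_det_invSqrt (hcov : (covMatrix PX).PosDef) :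
    IsUnit (invSqrt (covMatrix PX)).det :=
  Matrix.isUnit_nonsing_inv_det _ (isUnit_det_sqrtCov hcov)

theorem isUnit_whitenedCov_iff (hcov : (covMatrix PX).PosDef)
    (x : Fin n → EuclideanSpace ℝ (Fin d)) :
    IsUnit (whitenedCov PX x) ↔ IsUnit (sampleCov x) := by
  have h := isUnit_det_invSqrt hcov
  rw [Matrix.isUnit_iff_isUnit_det, Matrix.isUnit_iff_isUnit_det, whitenedCov, Matrix.det_mul,
    Matrix.det_mul, IsUnit.mul_iff, IsUnit.mul_iff]
  tauto

theorem norm_sq_sqrtCov (hmom : MemLp id 2 PX) (hcov : (covMatrix PX).PosDef)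
    (u : EuclideanSpace ℝ (Fin d)) : ‖euclOp (sqrtCov PX) u‖ ^ 2 = ∫ x, ⟪u, x⟫ ^ 2 ∂PX := by
  rw [← real_inner_self_eq_norm_sq, inner_euclOp_comm isHermitian_sqrtCov, ← euclOp_mul_apply,
    sqrtCov_mul_self hcov, inner_euclOp_covMatrix hmom]

/-! ### The excess error -/

/-- The law of `(X, ⟨w, X⟩ + η)`. -/
noncomputable def gaussLaw (PX : Measure (EuclideanSpace ℝ (Fin d))) (v : ℝ≥0)
    (w : EuclideanSpace ℝ (Fin d)) : Measure (EuclideanSpace ℝ (Fin d) × ℝ) :=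
  (PX.prod (gaussianReal 0 v)).map (fun z => (z.1, ⟪w, z.1⟫ + z.2))

/-- The noise is centred and independent of `X`, so the cross term integrates to zero and the noise
contributes the constant `v / 2`. -/
theorem expectedError_gaussLaw [IsProbabilityMeasure PX] (hmom : MemLp id 2 PX) (hcov : (covMatrix PX).PosDef) (v : ℝ≥0)
    (w u : EuclideanSpace ℝ (Fin d)) :
    expectedError squareError (gaussLaw PX v w) u
      = ‖euclOp (sqrtCov PX) (u - w)‖ ^ 2 / 2 + v / 2 := by
  unfold expectedError gaussLaw squareError
  rw [integral_map (by fun_prop) (Measurable.aestronglyMeasurable (by fun_prop))]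
  have e : ∀ z : EuclideanSpace ℝ (Fin d) × ℝ,
      (⟪u, z.1⟫ - (⟪w, z.1⟫ + z.2)) ^ 2 / 2
        = (⟪u - w, z.1⟫ ^ 2 * (1 / 2) - ⟪u - w, z.1⟫ * z.2) + z.2 ^ 2 * (1 / 2) := by
    intro z
    rw [inner_sub_left]
    ring
  simp_rw [e]
  have hg : MemLp (fun x : ℝ => x) 2 (gaussianReal 0 v) := memLp_id_gaussianReal' 2 (by simp)
  have hu := memLp_inner hmom (u - w)
  have i1 : Integrable (fun z : EuclideanSpace ℝ (Fin d) × ℝ => ⟪u - w, z.1⟫ ^ 2 * (1 / 2))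
      (PX.prod (gaussianReal 0 v)) :=
    (hu.integrable_sq.mul_const (1 / 2)).comp_fst _
  have i2 : Integrable (fun z : EuclideanSpace ℝ (Fin d) × ℝ => ⟪u - w, z.1⟫ * z.2)
      (PX.prod (gaussianReal 0 v)) :=
    (hu.integrable one_le_two).mul_prod (hg.integrable one_le_two)
  have i3 : Integrable (fun z : EuclideanSpace ℝ (Fin d) × ℝ => z.2 ^ 2 * (1 / 2))
      (PX.prod (gaussianReal 0 v)) :=
    (hg.integrable_sq.mul_const (1 / 2)).comp_snd _
  have i12 : Integrable (fun z : EuclideanSpace ℝ (Fin d) × ℝ =>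
      ⟪u - w, z.1⟫ ^ 2 * (1 / 2) - ⟪u - w, z.1⟫ * z.2) (PX.prod (gaussianReal 0 v)) := i1.sub i2
  rw [integral_add i12 i3, integral_sub i1 i2,
    integral_fun_fst (fun x : EuclideanSpace ℝ (Fin d) => ⟪u - w, x⟫ ^ 2 * (1 / 2)),
    integral_fun_snd (fun x : ℝ => x ^ 2 * (1 / 2)),
    integral_prod_mul (fun x : EuclideanSpace ℝ (Fin d) => ⟪u - w, x⟫) (fun x : ℝ => x),
    integral_mul_const, integral_mul_const, ← norm_sq_sqrtCov hmom hcov]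
  have hv : ∫ x, x ^ 2 ∂(gaussianReal 0 v) = v := by
    have h := variance_fun_id_gaussianReal (μ := 0) (v := v)
    rw [variance_of_integral_eq_zero (by fun_prop) (by simp)] at h
    exact h
  rw [hv]
  simp
  ring

theorem excessError_gaussLaw [IsProbabilityMeasure PX] (hmom : MemLp id 2 PX) (hcov : (covMatrix PX).PosDef) (v : ℝ≥0)
    (w u : EuclideanSpace ℝ (Fin d)) :
    excessError squareError (gaussLaw PX v w) u
      = ‖euclOp (sqrtCov PX) (u - w)‖ ^ 2 / 2 := by
  have hinf : ⨅ u, expectedError squareError (gaussLaw PX v w) u = v / 2 := by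
    simp_rw [expectedError_gaussLaw hmom hcov]
    refine le_antisymm ?_ (le_ciInf fun u => ?_)
    · refine (ciInf_le ⟨0, ?_⟩ w).trans_eq (by simp)
      rintro _ ⟨u, rfl⟩
      positivity
    · have : 0 ≤ ‖euclOp (sqrtCov PX) (u - w)‖ ^ 2 := by positivity
      linarith
  rw [excessError, hinf, expectedError_gaussLaw hmom hcov]
  ring

/-! ### The whitened sample covariance matrix in its eigenbasis -/

/-- Diagonalization reduces a fixed design to its eigenvalues. The Gram identity says that the
coordinates of the whitened inputs form orthogonal vectors in `ℝⁿ` of squared length `n * l j`; both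
bounds draw their independent Gaussian coordinates from it. -/
theorem whitenedCov_eigen (hcov : (covMatrix PX).PosDef) (hd : 0 < d) (hn : 0 < n)
    (x : Fin n → EuclideanSpace ℝ (Fin d)) :
    ∃ (b : OrthonormalBasis (Fin d) ℝ (EuclideanSpace ℝ (Fin d))) (l : Fin d → ℝ),
      (∀ j, euclOp (whitenedCov PX x) (b j) = l j • b j) ∧
      (∀ j, 0 ≤ l j) ∧
      (∀ j k, ∑ i, ⟪b j, euclOp (invSqrt (covMatrix PX)) (x i)⟫
          * ⟪b k, euclOp (invSqrt (covMatrix PX)) (x i)⟫ = if j = k then n * l j else 0) ∧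
      ((sampleCov x).rank < d ↔ ∃ j, l j = 0) ∧
      ((∀ j, 0 < l j) → traceInv (whitenedCov PX x) = ENNReal.ofReal (∑ j, (l j)⁻¹)) ∧
      ((∃ j, l j = 0) → traceInv (whitenedCov PX x) = ∞) ∧
      (∀ j, lambdaMin (whitenedCov PX x) ≤ l j) ∧ ∃ k, lambdaMin (whitenedCov PX x) = l k := by
  have hA := isHermitian_whitenedCov PX x
  set A := whitenedCov PX x with hAdef
  set S := invSqrt (covMatrix PX) with hS
  have hSH : S.IsHermitian := isHermitian_invSqrt _
  have hn' : (0 : ℝ) < n := by exact_mod_cast hn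
  have : Nonempty (Fin d) := ⟨⟨0, hd⟩⟩
  set b := hA.eigenvectorBasis with hb
  set l := hA.eigenvalues with hl
  have heig : ∀ j, euclOp A (b j) = l j • b j := fun j => by
    apply WithLp.ofLp_injective
    rw [Matrix.ofLp_toEuclideanCLM]
    exact hA.mulVec_eigenvectorBasis j
  have hgram : ∀ j k, ∑ i, ⟪b j, euclOp S (x i)⟫ * ⟪b k, euclOp S (x i)⟫
      = if j = k then n * l j else 0 := by
    intro j k
    have h1 : ⟪b j, euclOp A (b k)⟫
        = (n : ℝ)⁻¹ * ∑ i, ⟪b j, euclOp S (x i)⟫ * ⟪b k, euclOp S (x i)⟫ := by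
      rw [hAdef, whitenedCov, ← hS, Matrix.mul_assoc, euclOp_mul_apply, euclOp_mul_apply,
        ← inner_euclOp_comm hSH, inner_euclOp_sampleCov]
      congr 1
      refine Finset.sum_congr rfl fun i _ => ?_
      rw [inner_euclOp_comm hSH, ← inner_euclOp_comm hSH (x i),
        real_inner_comm (b k) (euclOp S (x i))]
    rw [heig, inner_smul_right, b.inner_eq_ite] at h1
    have h2 : ∑ i, ⟪b j, euclOp S (x i)⟫ * ⟪b k, euclOp S (x i)⟫
        = n * (l k * if j = k then 1 else 0) := by
      rw [h1]; field_simp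
    rw [h2]
    split_ifs with h
    · rw [h, mul_one]
    · simp
  have hnn : ∀ j, 0 ≤ l j := by
    intro j
    have h1 := hgram j j
    rw [if_pos rfl] at h1
    have h2 : 0 ≤ (n : ℝ) * l j := by
      rw [← h1]
      exact Finset.sum_nonneg fun i _ => mul_self_nonneg _
    exact nonneg_of_mul_nonneg_right h2 hn'
  have hunit : ¬ IsUnit A ↔ ∃ j, l j = 0 := by
    rw [Matrix.isUnit_iff_isUnit_det, isUnit_iff_ne_zero, not_not, hA.det_eq_prod_eigenvalues]
    simp [Finset.prod_eq_zero_iff, hl]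
  refine ⟨b, l, heig, hnn, hgram, ?_, ?_, ?_, ?_, ?_⟩
  · rw [rank_lt_iff_not_isUnit, ← isUnit_whitenedCov_iff hcov, hunit]
  · intro hpos
    have hU : IsUnit A := by
      by_contra h
      obtain ⟨j, hj⟩ := hunit.1 h
      exact (hpos j).ne' hj
    rw [traceInv, if_pos hU, trace_eq_sum_inner_euclOp _ b]
    congr 1
    refine Finset.sum_congr rfl fun j _ => ?_
    have h1 : euclOp A⁻¹ (b j) = (l j)⁻¹ • b j := by
      have h2 : euclOp A⁻¹ (euclOp A (b j)) = b j := by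
        rw [← euclOp_mul_apply, Matrix.nonsing_inv_mul _ ((Matrix.isUnit_iff_isUnit_det A).1 hU),
          euclOp_one_apply]
      rw [heig, map_smul] at h2
      rw [← h2, smul_smul, inv_mul_cancel₀ (hpos j).ne', one_smul, h2]
    rw [h1, inner_smul_right, b.inner_eq_one, mul_one]
  · intro h
    rw [traceInv, if_neg (hunit.2 h)]
  · intro j
    rw [lambdaMin, hA.spectrum_real_eq_range_eigenvalues]
    exact csInf_le (Set.finite_range _).bddBelow ⟨j, rfl⟩
  · rw [lambdaMin, hA.spectrum_real_eq_range_eigenvalues]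
    obtain ⟨k, hk⟩ := (Set.range_nonempty hA.eigenvalues).csInf_mem (Set.finite_range _)
    exact ⟨k, hk.symm⟩

end Operators

/-! ### Quantiles -/

section Quantiles

variable {Ω : Type*} [MeasurableSpace Ω] {μ : Measure Ω} {X : Ω → ℝ≥0∞} {p : ℝ}

theorem quantile_le_coe {t : ℝ≥0} (h : p ≤ μ.real {ω | X ω ≤ t}) : quantile μ X p ≤ t :=
  iInf₂_le t h

theorem le_measureReal_of_quantile_lt [IsFiniteMeasure μ] {t : ℝ≥0∞} (h : quantile μ X p < t) :
    p ≤ μ.real {ω | X ω ≤ t} := by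
  simp only [quantile, iInf_lt_iff] at h
  obtain ⟨s, hs, hst⟩ := h
  exact hs.trans (measureReal_mono fun ω hω => le_trans hω hst.le)

/-- Testing all admissible levels avoids attainment of the infima and covers infinite quantiles. A
zero `c` must be excluded because `0 * ∞ = 0`. -/
theorem le_mul_quantile_add_quantile {Ω' : Type*} [MeasurableSpace Ω'] {μ' : Measure Ω'}
    {X' : Ω' → ℝ≥0∞} {L : ℝ≥0∞} {c : ℝ≥0} (hc : c ≠ 0)
    (h : ∀ a b : ℝ≥0, p ≤ μ.real {ω | X ω ≤ a} → p ≤ μ'.real {ω | X' ω ≤ b} →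
      L ≤ ((c * (a + b) : ℝ≥0) : ℝ≥0∞)) :
    L ≤ c * (quantile μ X p + quantile μ' X' p) := by
  have hc0 : (c : ℝ≥0∞) ≠ 0 := by simpa using hc
  have key : ∀ a : ℝ≥0, p ≤ μ.real {ω | X ω ≤ a} → L / c ≤ a + quantile μ' X' p := by
    intro a ha
    rw [← tsub_le_iff_left]
    refine le_iInf₂ fun b hb => ?_
    rw [tsub_le_iff_left]
    refine ENNReal.div_le_of_le_mul' ?_
    exact_mod_cast h a b ha hb
  have h2 : L / c ≤ quantile μ X p + quantile μ' X' p := by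
    rw [← tsub_le_iff_right]
    refine le_iInf₂ fun a ha => ?_
    rw [tsub_le_iff_right]
    exact key a ha
  rwa [ENNReal.div_le_iff_le_mul (Or.inl hc0) (Or.inl (by simp)), mul_comm] at h2

end Quantiles

/-! ### The regression sample and its conditioning on the design -/

section Data

variable {d n : ℕ} {PX : Measure (EuclideanSpace ℝ (Fin d))}

/-- The law of `n` i.i.d. copies of `X`. -/
noncomputable abbrev designLaw (PX : Measure (EuclideanSpace ℝ (Fin d))) (n : ℕ) :
    Measure (Fin n → EuclideanSpace ℝ (Fin d)) :=
  Measure.pi fun _ : Fin n => PX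

/-- The regression sample with inputs `x`, parameter `w` and noise `√v h`. -/
noncomputable def sample (v : ℝ≥0) (w : EuclideanSpace ℝ (Fin d))
    (x : Fin n → EuclideanSpace ℝ (Fin d)) (h : Fin n → ℝ) :
    Fin n → EuclideanSpace ℝ (Fin d) × ℝ :=
  fun i => (x i, ⟪w, x i⟫ + √v * h i)

@[fun_prop]
theorem measurable_sample (v : ℝ≥0) :
    Measurable fun q : EuclideanSpace ℝ (Fin d) × (Fin n → EuclideanSpace ℝ (Fin d)) × (Fin n → ℝ) =>
      sample v q.1 q.2.1 q.2.2 := by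
  unfold sample
  fun_prop

instance isProbabilityMeasure_gaussLaw [IsProbabilityMeasure PX] (v : ℝ≥0) (w : EuclideanSpace ℝ (Fin d)) :
    IsProbabilityMeasure (gaussLaw PX v w) :=
  Measure.isProbabilityMeasure_map (by fun_prop)

theorem gaussianReal_eq_map_sqrt_mul (v : ℝ≥0) :
    gaussianReal 0 v = (gaussianReal 0 1).map (fun x => √v * x) := by
  rw [gaussianReal_map_const_mul]
  congr 1
  · simp
  · rw [mul_one]
    ext
    simp

/-- Separates the design from the noise, so that probabilities can be computed for a fixed design
and then integrated. -/
theorem pi_gaussLaw [IsProbabilityMeasure PX] (v : ℝ≥0) (w : EuclideanSpace ℝ (Fin d)) :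
    Measure.pi (fun _ : Fin n => gaussLaw PX v w)
      = ((designLaw PX n).prod (stdNormalPi (Fin n))).map (fun q => sample v w q.1 q.2) := by
  have h1 : gaussLaw PX v w
      = (PX.prod (gaussianReal 0 1)).map (fun z => (z.1, ⟪w, z.1⟫ + √v * z.2)) := by
    rw [gaussLaw, gaussianReal_eq_map_sqrt_mul]
    conv_lhs => rw [← Measure.map_id (μ := PX)]
    rw [Measure.map_prod_map _ _ measurable_id (by fun_prop),
      Measure.map_map (by fun_prop) (by fun_prop)]
    rfl
  have h2 := (measurePreserving_arrowProdEquivProdArrow (EuclideanSpace ℝ (Fin d)) ℝ (Fin n)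
    (fun _ => PX) (fun _ => gaussianReal 0 1)).map_eq
  have : IsProbabilityMeasure
      ((PX.prod (gaussianReal 0 1)).map (fun z => (z.1, ⟪w, z.1⟫ + √v * z.2))) :=
    Measure.isProbabilityMeasure_map (by fun_prop)
  simp_rw [h1]
  rw [← Measure.pi_map_pi (fun _ => by fun_prop), ← h2,
    Measure.map_map (by unfold sample; fun_prop) (MeasurableEquiv.measurable _)]
  rfl

theorem pi_gaussLaw_apply [IsProbabilityMeasure PX] (v : ℝ≥0) (w : EuclideanSpace ℝ (Fin d))
    {S : Set (Fin n → EuclideanSpace ℝ (Fin d) × ℝ)} (hS : MeasurableSet S) :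
    Measure.pi (fun _ : Fin n => gaussLaw PX v w) S
      = ∫⁻ x, stdNormalPi (Fin n) {h | sample v w x h ∈ S} ∂(designLaw PX n) := by
  have hm : Measurable fun q : (Fin n → EuclideanSpace ℝ (Fin d)) × (Fin n → ℝ) =>
      sample v w q.1 q.2 := by unfold sample; fun_prop
  rw [pi_gaussLaw, Measure.map_apply hm hS, Measure.prod_apply (hm hS)]
  rfl

/-! ### Measurability -/

theorem measurableSet_rank_lt :
    MeasurableSet {x : Fin n → EuclideanSpace ℝ (Fin d) | (sampleCov x).rank < d} := by
  have h : {x : Fin n → EuclideanSpace ℝ (Fin d) | (sampleCov x).rank < d}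
      = {x | (sampleCov x).det = 0} := by
    ext x
    simp [rank_lt_iff_not_isUnit, Matrix.isUnit_iff_isUnit_det]
  have hc : Continuous (sampleCov : (Fin n → EuclideanSpace ℝ (Fin d)) → _) := by
    refine continuous_matrix fun a b => ?_
    simp only [sampleCov, Matrix.of_apply]
    fun_prop
  rw [h]
  exact (isClosed_eq hc.matrix_det continuous_const).measurableSet

theorem measurable_inv_whitenedCov (a b : Fin d) :
    Measurable fun x : Fin n → EuclideanSpace ℝ (Fin d) => (whitenedCov PX x)⁻¹ a b := by
  have hc := continuous_whitenedCov (n := n) PX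
  simp only [Matrix.inv_def, Ring.inverse_eq_inv', Matrix.smul_apply, smul_eq_mul]
  exact hc.matrix_det.measurable.inv.mul
    ((continuous_apply_apply a b).comp hc.matrix_adjugate).measurable

theorem measurable_traceInv_whitenedCov :
    Measurable fun x : Fin n → EuclideanSpace ℝ (Fin d) => traceInv (whitenedCov PX x) := by
  unfold traceInv
  refine Measurable.ite ?_ (ENNReal.measurable_ofReal.comp ?_) measurable_const
  · have h : {x : Fin n → EuclideanSpace ℝ (Fin d) | IsUnit (whitenedCov PX x)}
        = {x | (whitenedCov PX x).det = 0}ᶜ := by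
      ext x
      simp [Matrix.isUnit_iff_isUnit_det]
    rw [h]
    exact (isClosed_eq (continuous_whitenedCov PX).matrix_det
      continuous_const).measurableSet.compl
  · simp only [Matrix.trace, Matrix.diag]
    exact Finset.measurable_fun_sum _ fun a _ => measurable_inv_whitenedCov a a

/-! ### The law of `W` -/

theorem expLaw_real_le {r : ℝ} (hr : 0 ≤ r) (t : ℝ≥0) :
    (expLaw r).real {y | y ≤ (t : ℝ≥0∞)} = 1 - Real.exp (-(r * t)) := by
  rcases hr.eq_or_lt with rfl | hr
  · simp [expLaw, Measure.real]
  · have := isProbabilityMeasure_expMeasure hr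
    have hS : MeasurableSet {y : ℝ≥0∞ | y ≤ (t : ℝ≥0∞)} := measurableSet_Iic
    rw [expLaw, if_pos hr, map_measureReal_apply ENNReal.measurable_ofReal hS]
    have h : ENNReal.ofReal ⁻¹' {y | y ≤ (t : ℝ≥0∞)} = Set.Iic (t : ℝ) := by
      ext y
      simp [ENNReal.ofReal_le_iff_le_toReal]
    rw [h, ← cdf_eq_real, cdf_expMeasure_eq hr]
    exact if_pos t.2

theorem lambdaMin_whitenedCov_nonneg (hcov : (covMatrix PX).PosDef) (hd : 0 < d) (hn : 0 < n)
    (x : Fin n → EuclideanSpace ℝ (Fin d)) : 0 ≤ lambdaMin (whitenedCov PX x) := by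
  obtain ⟨b, l, -, hl, -, -, -, -, -, k, hk⟩ := whitenedCov_eigen hcov hd hn x
  exact hk ▸ hl k

theorem lambdaMin_whitenedCov_eq_zero (hcov : (covMatrix PX).PosDef) (hd : 0 < d) (hn : 0 < n)
    {x : Fin n → EuclideanSpace ℝ (Fin d)} (hx : (sampleCov x).rank < d) :
    lambdaMin (whitenedCov PX x) = 0 := by
  refine le_antisymm ?_ (lambdaMin_whitenedCov_nonneg hcov hd hn x)
  obtain ⟨b, l, -, -, -, hr, -, -, hm, -⟩ := whitenedCov_eigen hcov hd hn x
  obtain ⟨j, hj⟩ := hr.1 hx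
  exact hj ▸ hm j

theorem integrable_one_sub_exp [IsProbabilityMeasure PX] (hcov : (covMatrix PX).PosDef) (hd : 0 < d) (hn : 0 < n) (t : ℝ≥0) :
    Integrable (fun x => 1 - Real.exp (-(lambdaMin (whitenedCov PX x) * t))) (designLaw PX n) := by
  refine Integrable.of_bound (C := 1) (Measurable.aestronglyMeasurable ?_)
    (Filter.Eventually.of_forall fun x => ?_)
  · have := measurable_lambdaMin_whitenedCov (n := n) PX
    fun_prop
  · have h1 : Real.exp (-(lambdaMin (whitenedCov PX x) * t)) ≤ 1 := by
      have := mul_nonneg (lambdaMin_whitenedCov_nonneg hcov hd hn x) t.2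
      rw [Real.exp_le_one_iff]
      simpa using this
    rw [Real.norm_of_nonneg (by linarith)]
    linarith [Real.exp_pos (-(lambdaMin (whitenedCov PX x) * t))]

theorem jointLaw_real_le [IsProbabilityMeasure PX] (hcov : (covMatrix PX).PosDef) (hd : 0 < d) (hn : 0 < n) (t : ℝ≥0) :
    (jointLaw PX n).real {z | z.2 ≤ (t : ℝ≥0∞)}
      = ∫ x, (1 - Real.exp (-(lambdaMin (whitenedCov PX x) * t))) ∂(designLaw PX n) := by
  have hS : MeasurableSet {z : (Fin n → EuclideanSpace ℝ (Fin d)) × ℝ≥0∞ | z.2 ≤ (t : ℝ≥0∞)} :=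
    measurableSet_le measurable_snd measurable_const
  rw [measureReal_def, jointLaw, Measure.compProd_apply hS,
    ← integral_toReal (Kernel.measurable_kernel_prodMk_left hS).aemeasurable
      (Filter.Eventually.of_forall fun x => measure_lt_top _ _)]
  refine integral_congr_ae (Filter.Eventually.of_forall fun x => ?_)
  exact expLaw_real_le (lambdaMin_whitenedCov_nonneg hcov hd hn x) t

end Data

/-! ### Least squares and the upper bound -/

section LeastSquares

variable {d n : ℕ} {PX : Measure (EuclideanSpace ℝ (Fin d))}

/-- The least squares procedure, written in whitened coordinates. -/
noncomputable def leastSquares (PX : Measure (EuclideanSpace ℝ (Fin d)))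
    (D : Fin n → EuclideanSpace ℝ (Fin d) × ℝ) : EuclideanSpace ℝ (Fin d) :=
  euclOp (invSqrt (covMatrix PX)) (euclOp (whitenedCov PX fun i => (D i).1)⁻¹
    ((n : ℝ)⁻¹ • ∑ i, (D i).2 • euclOp (invSqrt (covMatrix PX)) (D i).1))

theorem measurable_euclOp_apply {α : Type*} [MeasurableSpace α]
    {M : α → Matrix (Fin d) (Fin d) ℝ} (hM : ∀ a b, Measurable fun t => M t a b)
    {ξ : α → EuclideanSpace ℝ (Fin d)} (hξ : Measurable ξ) :
    Measurable fun t => euclOp (M t) (ξ t) := by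
  refine (WithLp.measurable_toLp 2 (Fin d → ℝ)).comp (measurable_pi_lambda _ fun a => ?_)
  change Measurable fun t => ∑ b, M t a b * ξ t b
  refine Finset.measurable_fun_sum _ fun b _ => ?_
  have := hM a b
  fun_prop

theorem measurable_leastSquares :
    Measurable (leastSquares PX : (Fin n → EuclideanSpace ℝ (Fin d) × ℝ) → _) := by
  unfold leastSquares
  refine (euclOp (invSqrt (covMatrix PX))).measurable.comp
    (measurable_euclOp_apply (fun a b => ?_) (by fun_prop))
  exact (measurable_inv_whitenedCov (PX := PX) a b).comp
    (g := fun x : Fin n → EuclideanSpace ℝ (Fin d) => (whitenedCov PX x)⁻¹ a b) (by fun_prop)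

/-- The normal equations in whitened form: the contribution of `w` cancels and only noise remains.
-/
theorem sqrtCov_leastSquares_sub (hcov : (covMatrix PX).PosDef) (hn : 0 < n)
    {x : Fin n → EuclideanSpace ℝ (Fin d)} (hx : IsUnit (whitenedCov PX x)) (v : ℝ≥0)
    (w : EuclideanSpace ℝ (Fin d)) (h : Fin n → ℝ) :
    euclOp (whitenedCov PX x) (euclOp (sqrtCov PX) (leastSquares PX (sample v w x h) - w))
      = (√v / n) • ∑ i, h i • euclOp (invSqrt (covMatrix PX)) (x i) := by
  have hn' : (n : ℝ) ≠ 0 := by exact_mod_cast hn.ne'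
  set S := invSqrt (covMatrix PX) with hS
  have hSH : S.IsHermitian := isHermitian_invSqrt _
  have hRS : ∀ u, euclOp (sqrtCov PX) (euclOp S u) = u := fun u => by
    rw [← euclOp_mul_apply, sqrtCov_mul_invSqrt hcov, euclOp_one_apply]
  have hSR : ∀ u, euclOp S (euclOp (sqrtCov PX) u) = u := fun u => by
    rw [← euclOp_mul_apply, invSqrt_mul_sqrtCov hcov, euclOp_one_apply]
  have hAA : ∀ u, euclOp (whitenedCov PX x) (euclOp (whitenedCov PX x)⁻¹ u) = u := fun u => by
    rw [← euclOp_mul_apply, Matrix.mul_nonsing_inv _ ((Matrix.isUnit_iff_isUnit_det _).1 hx),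
      euclOp_one_apply]
  have hw : euclOp (whitenedCov PX x) (euclOp (sqrtCov PX) w)
      = (n : ℝ)⁻¹ • ∑ i, ⟪w, x i⟫ • euclOp S (x i) := by
    rw [whitenedCov, ← hS, euclOp_mul_apply, euclOp_mul_apply, hSR]
    refine ext_inner_left ℝ fun u => ?_
    rw [← inner_euclOp_comm hSH, inner_euclOp_sampleCov, inner_smul_right, inner_sum]
    congr 1
    refine Finset.sum_congr rfl fun i _ => ?_
    rw [inner_smul_right, inner_euclOp_comm hSH, real_inner_comm w (x i), mul_comm]
  rw [map_sub, map_sub, hw, leastSquares, ← hS, hRS]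
  change euclOp (whitenedCov PX x) (euclOp (whitenedCov PX x)⁻¹ _) - _ = _
  rw [hAA, ← smul_sub, ← Finset.sum_sub_distrib, div_eq_inv_mul, mul_smul, Finset.smul_sum (r := √v)]
  congr 1
  refine Finset.sum_congr rfl fun i _ => ?_
  simp only [sample]
  rw [← sub_smul, smul_smul]
  congr 1
  ring

/-- Conditionally on a nonsingular design, the error of least squares is bounded with the
probability of an exponential variable. -/
theorem leastSquares_tail (hcov : (covMatrix PX).PosDef) (hd : 0 < d) (hn : 0 < n)
    {v : ℝ≥0} (hv : 0 < v) (w : EuclideanSpace ℝ (Fin d)) {a b : ℝ≥0}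
    {x : Fin n → EuclideanSpace ℝ (Fin d)} (hx : traceInv (whitenedCov PX x) ≤ a) :
    1 - Real.exp (-(lambdaMin (whitenedCov PX x) * b))
      ≤ (stdNormalPi (Fin n)).real {h | ‖euclOp (sqrtCov PX)
          (leastSquares PX (sample v w x h) - w)‖ ^ 2 / 2 ≤ 2 * (v / n) * (a + b)} := by
  obtain ⟨e, l, heig, hl, hgram, hrank, htr, htr', hmin, k, hk⟩ := whitenedCov_eigen hcov hd hn x
  have hn' : (0 : ℝ) < n := by exact_mod_cast hn
  have hv' : (0 : ℝ) < v := by exact_mod_cast hv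
  have hpos : ∀ j, 0 < l j := by
    intro j
    refine lt_of_le_of_ne (hl j) fun h0 => ?_
    rw [htr' ⟨j, h0.symm⟩] at hx
    exact absurd hx (by simp)
  have hU : IsUnit (whitenedCov PX x) := by
    rw [isUnit_whitenedCov_iff hcov]
    by_contra h
    obtain ⟨j, hj⟩ := hrank.1 ((rank_lt_iff_not_isUnit _).2 h)
    exact (hpos j).ne' hj
  have hsum : ∑ j, (l j)⁻¹ ≤ a := by
    rw [htr hpos, ENNReal.ofReal_le_iff_le_toReal (by simp)] at hx
    simpa using hx
  -- Normalizing the orthogonal vectors of the Gram identity makes the noise coordinates along them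
  -- independent standard normals.
  set O : Fin d → Fin n → ℝ := fun j i =>
    ⟪e j, euclOp (invSqrt (covMatrix PX)) (x i)⟫ / √(n * l j) with hO
  have hq : ∀ j, 0 < √(n * l j) := fun j => Real.sqrt_pos.2 (mul_pos hn' (hpos j))
  have hq2 : ∀ j, √(n * l j) * √(n * l j) = n * l j := fun j =>
    Real.mul_self_sqrt (mul_pos hn' (hpos j)).le
  have horth : ∀ j j', O j ⬝ᵥ O j' = if j = j' then 1 else 0 := by
    intro j j'
    simp only [hO, dotProduct, div_mul_div_comm]
    rw [← Finset.sum_div, hgram]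
    split_ifs with h
    · subst h
      rw [hq2, div_self (mul_pos hn' (hpos j)).ne']
    · simp
  have hmp := measurePreserving_linearForms O horth
  set σ : Fin d → ℝ := fun j => √v / √(n * l j) with hσ
  have hσ2 : ∀ j, σ j ^ 2 = v / n * (l j)⁻¹ := by
    intro j
    rw [hσ, div_pow, Real.sq_sqrt hv'.le, Real.sq_sqrt (mul_pos hn' (hpos j)).le]
    field_simp
  have hcoord : ∀ h : Fin n → ℝ, ∀ j, ⟪e j, euclOp (sqrtCov PX)
      (leastSquares PX (sample v w x h) - w)⟫ = σ j * linearForms O h j := by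
    intro h j
    have h1 := congrArg (fun u => ⟪e j, u⟫) (sqrtCov_leastSquares_sub hcov hn hU v w h)
    rw [← inner_euclOp_comm (isHermitian_whitenedCov PX x), heig, inner_smul_left, inner_smul_right,
      inner_sum] at h1
    simp only [inner_smul_right, conj_trivial] at h1
    have h2 : linearForms O h j
        = (∑ i, h i * ⟪e j, euclOp (invSqrt (covMatrix PX)) (x i)⟫) / √(n * l j) := by
      rw [linearForms_apply, dotProduct, Finset.sum_div]
      exact Finset.sum_congr rfl fun i _ => by simp only [hO]; ring
    rw [h2, hσ]
    have h3 := hpos j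
    have h4 : √v / √(n * l j) * ((∑ i, h i * ⟪e j, euclOp (invSqrt (covMatrix PX)) (x i)⟫)
        / √(n * l j)) = √v * (∑ i, h i * ⟪e j, euclOp (invSqrt (covMatrix PX)) (x i)⟫)
        / (√(n * l j) * √(n * l j)) := by
      have := hq j
      field_simp
    rw [h4, hq2, eq_div_iff (mul_pos hn' h3).ne']
    have h5 := congrArg (fun r : ℝ => (n : ℝ) * r) h1
    have h6 : (n : ℝ) * (√v / n * ∑ i, h i * ⟪e j, euclOp (invSqrt (covMatrix PX)) (x i)⟫)
        = √v * ∑ i, h i * ⟪e j, euclOp (invSqrt (covMatrix PX)) (x i)⟫ := by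
      field_simp
    rw [h6] at h5
    rw [← h5]
    ring
  have hnorm : ∀ h : Fin n → ℝ, ‖euclOp (sqrtCov PX) (leastSquares PX (sample v w x h) - w)‖ ^ 2
      = ∑ j, (σ j * linearForms O h j) ^ 2 := by
    intro h
    rw [← e.sum_sq_norm_inner_right]
    refine Finset.sum_congr rfl fun j _ => ?_
    rw [hcoord, Real.norm_eq_abs, sq_abs]
  have hm0 : 0 < lambdaMin (whitenedCov PX x) := hk ▸ hpos k
  set m := lambdaMin (whitenedCov PX x) with hm
  -- `M` is the largest coordinate variance and `τ = v b / n`, so `τ / M = λ_min b`.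
  have htail := stdNormalPi_tail_le σ (M := v / n * m⁻¹) (by positivity) (fun j => by
    rw [hσ2]
    have := hmin j
    gcongr) (v / n * b)
  have hexp : -(v / n * b) / (v / n * m⁻¹) = -(m * b) := by field_simp
  rw [hexp] at htail
  have hBm : MeasurableSet {z : Fin d → ℝ | 2 * ∑ j, σ j ^ 2 + 2 * (v / n * b)
      < (∑ j, (σ j * z j) ^ 2) / 2} := measurableSet_lt measurable_const (by fun_prop)
  have h1 := probReal_compl_eq_one_sub (μ := stdNormalPi (Fin d)) hBm
  have h2 := hmp.measureReal_preimage hBm.compl.nullMeasurableSet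
  calc 1 - Real.exp (-(m * b)) ≤ _ := sub_le_sub_left htail 1
    _ = _ := h1.symm
    _ = _ := h2.symm
    _ ≤ _ := by
      refine measureReal_mono fun h hh => ?_
      simp only [Set.mem_preimage, Set.mem_compl_iff, Set.mem_ofPred_eq, not_lt] at hh ⊢
      rw [hnorm]
      refine hh.trans ?_
      simp_rw [hσ2]
      rw [← Finset.mul_sum]
      have : (v : ℝ) / n * ∑ j, (l j)⁻¹ ≤ v / n * a := by gcongr
      linarith

theorem measureReal_pi_gaussLaw [IsProbabilityMeasure PX] (v : ℝ≥0) (w : EuclideanSpace ℝ (Fin d))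
    {S : Set (Fin n → EuclideanSpace ℝ (Fin d) × ℝ)} (hS : MeasurableSet S) :
    Integrable (fun x => (stdNormalPi (Fin n)).real {h | sample v w x h ∈ S}) (designLaw PX n) ∧
    (Measure.pi (fun _ : Fin n => gaussLaw PX v w)).real S
      = ∫ x, (stdNormalPi (Fin n)).real {h | sample v w x h ∈ S} ∂(designLaw PX n) := by
  have hm : Measurable fun q : (Fin n → EuclideanSpace ℝ (Fin d)) × (Fin n → ℝ) =>
      sample v w q.1 q.2 := by unfold sample; fun_prop
  have hmeas : Measurable fun x => stdNormalPi (Fin n) {h | sample v w x h ∈ S} :=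
    measurable_measure_prodMk_left (hm hS)
  refine ⟨?_, ?_⟩
  · refine Integrable.of_bound (C := 1) hmeas.ennreal_toReal.aestronglyMeasurable
      (Filter.Eventually.of_forall fun x => ?_)
    rw [Real.norm_of_nonneg measureReal_nonneg]
    exact measureReal_le_one
  · rw [measureReal_def, pi_gaussLaw_apply v w hS,
      ← integral_toReal hmeas.aemeasurable (Filter.Eventually.of_forall fun x => measure_lt_top _ _)]
    rfl

theorem measurableSet_excess_le {f : (Fin n → EuclideanSpace ℝ (Fin d) × ℝ) →
    EuclideanSpace ℝ (Fin d)} (hf : Measurable f) (w : EuclideanSpace ℝ (Fin d)) (r : ℝ) :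
    MeasurableSet {D | ‖euclOp (sqrtCov PX) (f D - w)‖ ^ 2 / 2 ≤ r} :=
  measurableSet_le (by fun_prop) measurable_const

theorem singular_real_compl [IsProbabilityMeasure PX] :
    (designLaw PX n).real {x | (sampleCov x).rank < d}ᶜ = 1 - singularProb PX n :=
  probReal_compl_eq_one_sub measurableSet_rank_lt

theorem minimaxQuantileRisk_gaussClass_le [IsProbabilityMeasure PX] (hmom : MemLp id 2 PX)
    (hcov : (covMatrix PX).PosDef) (hd : 0 < d) (hn : 0 < n) {v : ℝ≥0} (hv : 0 < v) (δ : ℝ) :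
    minimaxQuantileRisk n (singularProb PX n + δ) squareError (gaussClass PX v)
        ≤ 2 * ((v : ℝ≥0∞) / n) *
          (traceQuantile PX n (1 - singularProb PX n - δ / 2)
            + expQuantile PX n (1 - singularProb PX n - δ / 2)) := by
  have hn' : (n : ℝ≥0) ≠ 0 := by exact_mod_cast hn.ne'
  have hc : 2 * ((v : ℝ≥0∞) / n) = ((2 * (v / n) : ℝ≥0) : ℝ≥0∞) := by
    rw [ENNReal.coe_mul, ENNReal.coe_div hn']
    simp
  rw [hc]
  refine le_mul_quantile_add_quantile (by positivity) fun a b ha hb => ?_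
  refine iInf₂_le_of_le (leastSquares PX) measurable_leastSquares (iSup₂_le ?_)
  rintro _ ⟨w, rfl⟩
  refine quantile_le_coe ?_
  change _ ≤ (Measure.pi (fun _ : Fin n => gaussLaw PX v w)).real _
  set r : ℝ := 2 * (v / n) * (a + b) with hr
  set S := {D | ‖euclOp (sqrtCov PX) (leastSquares PX D - w)‖ ^ 2 / 2 ≤ r} with hS
  have hSm : MeasurableSet S := measurableSet_excess_le (n := n) measurable_leastSquares w r
  have hset : {D | ENNReal.ofReal (excessError squareError (gaussLaw PX v w) (leastSquares PX D))
      ≤ ((2 * (v / n) * (a + b) : ℝ≥0) : ℝ≥0∞)} = S := by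
    ext D
    simp only [Set.mem_ofPred_eq, hS, excessError_gaussLaw hmom hcov]
    rw [ENNReal.ofReal_le_iff_le_toReal ENNReal.coe_ne_top, ENNReal.coe_toReal]
    simp [hr]
  refine le_trans ?_ (le_of_eq (congrArg _ hset.symm))
  obtain ⟨hint, heq⟩ := measureReal_pi_gaussLaw (n := n) (PX := PX) v w hSm
  rw [heq]
  set N := {x : Fin n → EuclideanSpace ℝ (Fin d) | (sampleCov x).rank < d} with hN
  have hNm : MeasurableSet N := measurableSet_rank_lt
  set A := {x : Fin n → EuclideanSpace ℝ (Fin d) | traceInv (whitenedCov PX x) ≤ a} with hA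
  have hAm : MeasurableSet A := measurableSet_le measurable_traceInv_whitenedCov measurable_const
  have hW := integrable_one_sub_exp (PX := PX) hcov hd hn b
  -- A union bound relative to the nonsingular event `Nᶜ` instead of the whole space: on `N` the
  -- trace is infinite and `λ_min = 0`, so both positive terms vanish.
  have hmono : ∫ x, (A.indicator 1 x + (1 - Real.exp (-(lambdaMin (whitenedCov PX x) * b)))
      - Nᶜ.indicator 1 x) ∂(designLaw PX n)
      ≤ ∫ x, (stdNormalPi (Fin n)).real {h | sample v w x h ∈ S} ∂(designLaw PX n) := by
    refine integral_mono ((((integrable_const 1).indicator hAm).add hW).sub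
      ((integrable_const 1).indicator hNm.compl)) hint fun x => ?_
    have he := Real.exp_pos (-(lambdaMin (whitenedCov PX x) * b))
    simp only
    by_cases hxN : x ∈ N
    · have hxA : x ∉ A := by
        intro h
        obtain ⟨-, l, -, -, -, hrank, -, htr', -⟩ := whitenedCov_eigen hcov hd hn x
        have h2 : traceInv (whitenedCov PX x) ≤ a := h
        rw [htr' (hrank.1 hxN)] at h2
        exact absurd h2 (by simp)
      have h0 : lambdaMin (whitenedCov PX x) = 0 := lambdaMin_whitenedCov_eq_zero hcov hd hn hxN
      have hxN' : x ∉ Nᶜ := fun h => h hxN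
      rw [Set.indicator_of_notMem hxA, Set.indicator_of_notMem hxN', h0]
      simp
    · have hxN' : x ∈ Nᶜ := hxN
      rw [Set.indicator_of_mem hxN']
      by_cases hxA : x ∈ A
      · rw [Set.indicator_of_mem hxA]
        have := leastSquares_tail hcov hd hn hv w (b := b) (show traceInv (whitenedCov PX x) ≤ a from hxA)
        simp only [Pi.one_apply]
        refine le_trans (le_of_eq (by ring)) this
      · rw [Set.indicator_of_notMem hxA]
        simp only [Pi.one_apply]
        have h0 : 0 ≤ (stdNormalPi (Fin n)).real {h | sample v w x h ∈ S} := measureReal_nonneg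
        linarith
  refine le_trans ?_ hmono
  have i1 : Integrable (A.indicator (1 : (Fin n → EuclideanSpace ℝ (Fin d)) → ℝ)) (designLaw PX n) :=
    (integrable_const 1).indicator hAm
  have i2 : Integrable (Nᶜ.indicator (1 : (Fin n → EuclideanSpace ℝ (Fin d)) → ℝ)) (designLaw PX n) :=
    (integrable_const 1).indicator hNm.compl
  have i3 : Integrable (fun x => A.indicator (1 : (Fin n → EuclideanSpace ℝ (Fin d)) → ℝ) x
      + (1 - Real.exp (-(lambdaMin (whitenedCov PX x) * b)))) (designLaw PX n) := i1.add hW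
  rw [integral_sub i3 i2, integral_add i1 hW, integral_indicator_one hAm,
    integral_indicator_one hNm.compl, ← jointLaw_real_le hcov hd hn, singular_real_compl]
  -- `2(1 - ε - δ/2) - (1 - ε) = 1 - ε - δ`.
  linarith

end LeastSquares

/-! ### The Bayesian lower bound -/

section LowerBound

variable {d n : ℕ} {PX : Measure (EuclideanSpace ℝ (Fin d))}

/-- The set of prior draws `u` and noises `h` for which `f` estimates the parameter `T Σ^{-1/2} u`
with excess error at most `t`. -/
noncomputable def bayesSet (PX : Measure (EuclideanSpace ℝ (Fin d)))
    (f : (Fin n → EuclideanSpace ℝ (Fin d) × ℝ) → EuclideanSpace ℝ (Fin d)) (v : ℝ≥0) (t T : ℝ) :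
    Set (EuclideanSpace ℝ (Fin d) × (Fin n → EuclideanSpace ℝ (Fin d)) × (Fin n → ℝ)) :=
  {q | ‖euclOp (sqrtCov PX) (f (sample v (euclOp (invSqrt (covMatrix PX)) (T • q.1)) q.2.1 q.2.2)
      - euclOp (invSqrt (covMatrix PX)) (T • q.1))‖ ^ 2 / 2 ≤ t}

/-- The Bayesian probability of small excess error, conditionally on the design `x`. -/
noncomputable def bayesMass (PX : Measure (EuclideanSpace ℝ (Fin d)))
    (f : (Fin n → EuclideanSpace ℝ (Fin d) × ℝ) → EuclideanSpace ℝ (Fin d)) (v : ℝ≥0) (t T : ℝ)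
    (x : Fin n → EuclideanSpace ℝ (Fin d)) : ℝ≥0∞ :=
  ((stdGaussian (EuclideanSpace ℝ (Fin d))).prod (stdNormalPi (Fin n)))
    {q | (q.1, x, q.2) ∈ bayesSet PX f v t T}

variable {f : (Fin n → EuclideanSpace ℝ (Fin d) × ℝ) → EuclideanSpace ℝ (Fin d)}

theorem measurableSet_bayesSet (hf : Measurable f) (v : ℝ≥0) (t T : ℝ) :
    MeasurableSet (bayesSet PX f v t T) := by
  have h1 : Measurable fun q : EuclideanSpace ℝ (Fin d) × (Fin n → EuclideanSpace ℝ (Fin d))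
      × (Fin n → ℝ) => f (sample v (euclOp (invSqrt (covMatrix PX)) (T • q.1)) q.2.1 q.2.2) :=
    hf.comp ((measurable_sample v).comp (f := fun q : EuclideanSpace ℝ (Fin d) ×
      (Fin n → EuclideanSpace ℝ (Fin d)) × (Fin n → ℝ) =>
        (euclOp (invSqrt (covMatrix PX)) (T • q.1), q.2.1, q.2.2)) (by fun_prop))
  exact measurableSet_le (by fun_prop) measurable_const

theorem measurable_bayesMass (hf : Measurable f) (v : ℝ≥0) (t T : ℝ) :
    Measurable (bayesMass PX f v t T) := by
  have h : MeasurableSet ((fun p : (Fin n → EuclideanSpace ℝ (Fin d)) ×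
      (EuclideanSpace ℝ (Fin d) × (Fin n → ℝ)) => (p.2.1, p.1, p.2.2)) ⁻¹' bayesSet PX f v t T) :=
    (by fun_prop : Measurable _) (measurableSet_bayesSet hf v t T)
  exact measurable_measure_prodMk_left h

/-- A guarantee valid for every parameter survives averaging over the prior; Tonelli then moves the
design outermost, since its law does not depend on the parameter. -/
theorem le_lintegral_bayesMass [IsProbabilityMeasure PX] (hf : Measurable f) (v : ℝ≥0) (t T : ℝ)
    {p : ℝ≥0∞} (hp : ∀ w, p ≤ Measure.pi (fun _ : Fin n => gaussLaw PX v w)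
      {D | ‖euclOp (sqrtCov PX) (f D - w)‖ ^ 2 / 2 ≤ t}) :
    p ≤ ∫⁻ x, bayesMass PX f v t T x ∂(designLaw PX n) := by
  have hS := measurableSet_bayesSet (PX := PX) hf v t T
  calc p = ∫⁻ _ : EuclideanSpace ℝ (Fin d), p ∂(stdGaussian _) := by simp
    _ ≤ ∫⁻ u, ∫⁻ x, stdNormalPi (Fin n) {h | (u, x, h) ∈ bayesSet PX f v t T}
        ∂(designLaw PX n) ∂(stdGaussian (EuclideanSpace ℝ (Fin d))) := by
      refine lintegral_mono fun u => (hp _).trans_eq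
        (pi_gaussLaw_apply v (euclOp (invSqrt (covMatrix PX)) (T • u))
          (measurableSet_excess_le hf _ t))
    _ = ∫⁻ x, ∫⁻ u, stdNormalPi (Fin n) {h | (u, x, h) ∈ bayesSet PX f v t T}
        ∂(stdGaussian (EuclideanSpace ℝ (Fin d))) ∂(designLaw PX n) := by
      refine lintegral_lintegral_swap (Measurable.aemeasurable ?_)
      have h : MeasurableSet ((fun p : (EuclideanSpace ℝ (Fin d) ×
          (Fin n → EuclideanSpace ℝ (Fin d))) × (Fin n → ℝ) => (p.1.1, p.1.2, p.2)) ⁻¹'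
            bayesSet PX f v t T) := (by fun_prop : Measurable _) hS
      exact measurable_measure_prodMk_left h
    _ = _ := by
      refine lintegral_congr fun x => ?_
      have h : MeasurableSet {q : EuclideanSpace ℝ (Fin d) × (Fin n → ℝ) |
          (q.1, x, q.2) ∈ bayesSet PX f v t T} :=
        (by fun_prop : Measurable fun q : EuclideanSpace ℝ (Fin d) × (Fin n → ℝ) =>
          (q.1, x, q.2)) hS
      rw [bayesMass, Measure.prod_apply h]
      rfl

/-- The Bayesian mass is controlled by the posterior in the eigenbasis of the whitened sample
covariance. -/
theorem bayesMass_le (hcov : (covMatrix PX).PosDef) (hf : Measurable f) {v : ℝ≥0}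
    (hv : 0 < v) (t : ℝ) {T : ℝ} (hT : 0 < T) (x : Fin n → EuclideanSpace ℝ (Fin d))
    (e : OrthonormalBasis (Fin d) ℝ (EuclideanSpace ℝ (Fin d))) (l : Fin d → ℝ)
    (hl : ∀ j, 0 ≤ l j)
    (hgram : ∀ j k, ∑ i, ⟪e j, euclOp (invSqrt (covMatrix PX)) (x i)⟫
          * ⟪e k, euclOp (invSqrt (covMatrix PX)) (x i)⟫ = if j = k then n * l j else 0)
    {B : ℝ≥0∞}
    (hB : ∀ c : Fin d → ℝ, stdNormalPi (Fin d)
      {z | (∑ j, (√v / √(n * l j + √v ^ 2 / T ^ 2) * z j - c j) ^ 2) / 2 ≤ t} ≤ B) :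
    bayesMass PX f v t T x ≤ B := by
  have hv' : (0 : ℝ) < v := by exact_mod_cast hv
  have hSH : (invSqrt (covMatrix PX)).IsHermitian := isHermitian_invSqrt _
  set F : (Fin d → ℝ) → EuclideanSpace ℝ (Fin d) := fun g => ∑ j, g j • e j with hF
  have hFm : Measurable F := by simp only [hF]; fun_prop
  have hFe : ∀ g j, ⟪e j, F g⟫ = g j := fun g j => by
    simp only [hF, inner_sum, inner_smul_right, e.inner_eq_ite]
    simp
  have hm : MeasurableSet {q : EuclideanSpace ℝ (Fin d) × (Fin n → ℝ) |
      (q.1, x, q.2) ∈ bayesSet PX f v t T} :=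
    (by fun_prop : Measurable fun q : EuclideanSpace ℝ (Fin d) × (Fin n → ℝ) =>
      (q.1, x, q.2)) (measurableSet_bayesSet hf v t T)
  -- Rotation invariance of the prior allows it to be drawn in the eigenbasis of the given design.
  have hmap : (stdGaussian (EuclideanSpace ℝ (Fin d))).prod (stdNormalPi (Fin n))
      = ((stdNormalPi (Fin d)).prod (stdNormalPi (Fin n))).map (Prod.map F id) := by
    rw [stdGaussian_eq_map_pi_orthonormalBasis e]
    conv_lhs => rw [← Measure.map_id (μ := stdNormalPi (Fin n))]
    exact Measure.map_prod_map _ _ hFm measurable_id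
  rw [bayesMass, hmap, Measure.map_apply (by fun_prop) hm]
  set φ : (Fin n → ℝ) → Fin d → ℝ := fun y j =>
    ⟪e j, euclOp (sqrtCov PX) (f fun i => (x i, y i))⟫ with hφ
  have hφm : Measurable φ := by
    have h1 : Measurable fun y : Fin n → ℝ => f fun i => (x i, y i) := hf.comp (by fun_prop)
    fun_prop
  refine le_of_eq_of_le (congrArg _ ?_) (bayes_ball_le
    (fun i j => ⟪e j, euclOp (invSqrt (covMatrix PX)) (x i)⟫) (fun j => n * l j)
    (fun j => mul_nonneg n.cast_nonneg (hl j)) hgram hT (Real.sqrt_pos.2 hv') φ hφm t hB)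
  ext p
  have hsam : sample v (euclOp (invSqrt (covMatrix PX)) (T • F p.1)) x p.2
      = fun i => (x i, ∑ k, ⟪e k, euclOp (invSqrt (covMatrix PX)) (x i)⟫ * (T * p.1 k)
          + √v * p.2 i) := by
    funext i
    simp only [sample]
    congr 2
    rw [inner_euclOp_comm hSH, inner_smul_left, hF, sum_inner, Finset.mul_sum]
    refine Finset.sum_congr rfl fun k _ => ?_
    rw [inner_smul_left]
    simp
    ring
  simp only [Set.mem_preimage, bayesSet, Set.mem_ofPred_eq, Prod.map_fst, Prod.map_snd, id]
  rw [hsam, map_sub, ← euclOp_mul_apply, sqrtCov_mul_invSqrt hcov, euclOp_one_apply,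
    ← e.sum_sq_norm_inner_right]
  have : ∀ j, ‖⟪e j, euclOp (sqrtCov PX) (f fun i =>
      (x i, ∑ k, ⟪e k, euclOp (invSqrt (covMatrix PX)) (x i)⟫ * (T * p.1 k) + √v * p.2 i))
        - T • F p.1⟫‖ ^ 2
      = (φ (fun i => ∑ k, ⟪e k, euclOp (invSqrt (covMatrix PX)) (x i)⟫ * (T * p.1 k)
          + √v * p.2 i) j - T * p.1 j) ^ 2 := by
    intro j
    rw [inner_sub_right, inner_smul_right, hFe, Real.norm_eq_abs, sq_abs]
  simp_rw [this]

/-! ### Flat-prior limit of the posterior mass -/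

theorem limsup_le_ofReal {F : ℕ → ℝ≥0∞} {B : ℕ → ℝ} {b : ℝ} (h : ∀ k, F k ≤ ENNReal.ofReal (B k))
    (hB : Filter.Tendsto B Filter.atTop (nhds b)) :
    Filter.limsup F Filter.atTop ≤ ENNReal.ofReal b := by
  rw [← ((ENNReal.continuous_ofReal.tendsto b).comp hB).limsup_eq]
  exact Filter.limsup_le_limsup (Filter.Eventually.of_forall h)

/-- The asymptotic Bayesian mass as the prior variance tends to infinity. -/
noncomputable def bayesLimsup (PX : Measure (EuclideanSpace ℝ (Fin d)))
    (f : (Fin n → EuclideanSpace ℝ (Fin d) × ℝ) → EuclideanSpace ℝ (Fin d)) (v : ℝ≥0) (t : ℝ)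
    (x : Fin n → EuclideanSpace ℝ (Fin d)) : ℝ≥0∞ :=
  Filter.limsup (fun k : ℕ => bayesMass PX f v t (k + 1) x) Filter.atTop

/-- Reverse Fatou with dominating function `1`. Passing to the limit inside the integral lets `T →
∞` for each design separately, without uniformity in the design. -/
theorem le_lintegral_bayesLimsup [IsProbabilityMeasure PX] (hf : Measurable f) (v : ℝ≥0) (t : ℝ)
    {p : ℝ≥0∞} (hp : ∀ w, p ≤ Measure.pi (fun _ : Fin n => gaussLaw PX v w)
      {D | ‖euclOp (sqrtCov PX) (f D - w)‖ ^ 2 / 2 ≤ t}) :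
    p ≤ ∫⁻ x, bayesLimsup PX f v t x ∂(designLaw PX n) := by
  have h1 := limsup_lintegral_le (μ := designLaw PX n)
    (f := fun k : ℕ => bayesMass PX f v t (k + 1)) (fun _ => 1)
    (fun k => measurable_bayesMass hf v t _)
    (fun k => Filter.Eventually.of_forall fun x => prob_le_one) (by simp)
  refine le_trans ?_ h1
  refine Filter.le_limsup_of_frequently_le (Filter.Frequently.of_forall fun k => ?_)
    (by isBoundedDefault)
  exact le_lintegral_bayesMass hf v t _ hp

theorem tendsto_div_nat_sq (c : ℝ) :
    Filter.Tendsto (fun k : ℕ => c / ((k : ℝ) + 1) ^ 2) Filter.atTop (nhds 0) := by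
  have h : Filter.Tendsto (fun k : ℕ => ((k : ℝ) + 1) ^ 2) Filter.atTop Filter.atTop :=
    (Filter.tendsto_pow_atTop two_ne_zero).comp
      (Filter.tendsto_atTop_add_const_right _ _ tendsto_natCast_atTop_atTop)
  exact h.const_div_atTop c

theorem bayesMass_le_trace (hcov : (covMatrix PX).PosDef) (hf : Measurable f) {v : ℝ≥0}
    (hv : 0 < v) {t : ℝ} (ht : 0 < t) {T : ℝ} (hT : 0 < T) (x : Fin n → EuclideanSpace ℝ (Fin d))
    (e : OrthonormalBasis (Fin d) ℝ (EuclideanSpace ℝ (Fin d))) (l : Fin d → ℝ)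
    (hl : ∀ j, 0 ≤ l j)
    (hgram : ∀ j k, ∑ i, ⟪e j, euclOp (invSqrt (covMatrix PX)) (x i)⟫
          * ⟪e k, euclOp (invSqrt (covMatrix PX)) (x i)⟫ = if j = k then n * l j else 0) :
    bayesMass PX f v t T x
      ≤ ENNReal.ofReal (Real.exp 1 / √(1 + (∑ j, v / (n * l j + v / T ^ 2)) / t)) := by
  refine bayesMass_le hcov hf hv t hT x e l hl hgram fun c => ?_
  rw [← ofReal_measureReal]
  refine ENNReal.ofReal_le_ofReal ((stdNormalPi_small_ball_le _ c ht).trans_eq ?_)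
  congr 4
  refine Finset.sum_congr rfl fun j _ => ?_
  have := mul_nonneg (n.cast_nonneg (α := ℝ)) (hl j)
  rw [div_pow, Real.sq_sqrt v.coe_nonneg, Real.sq_sqrt (by positivity)]

theorem bayesMass_le_eigenvalue (hcov : (covMatrix PX).PosDef) (hf : Measurable f) {v : ℝ≥0}
    (hv : 0 < v) {t : ℝ} (ht : 0 < t) {T : ℝ} (hT : 0 < T) (x : Fin n → EuclideanSpace ℝ (Fin d))
    (e : OrthonormalBasis (Fin d) ℝ (EuclideanSpace ℝ (Fin d))) (l : Fin d → ℝ)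
    (hl : ∀ j, 0 ≤ l j)
    (hgram : ∀ j k, ∑ i, ⟪e j, euclOp (invSqrt (covMatrix PX)) (x i)⟫
          * ⟪e k, euclOp (invSqrt (covMatrix PX)) (x i)⟫ = if j = k then n * l j else 0)
    (k : Fin d) :
    bayesMass PX f v t T x
      ≤ ENNReal.ofReal (1 - 1 / 4 * Real.exp (-(9 * t * (n * l k + v / T ^ 2) / v))) := by
  refine bayesMass_le hcov hf hv t hT x e l hl hgram fun c => ?_
  have hv' : (0 : ℝ) < v := by exact_mod_cast hv
  have h0 := mul_nonneg (n.cast_nonneg (α := ℝ)) (hl k)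
  rw [← ofReal_measureReal]
  have hσ : 0 < √v / √(n * l k + √v ^ 2 / T ^ 2) := by positivity
  refine ENNReal.ofReal_le_ofReal ((stdNormalPi_ball_le _ c k hσ ht.le).trans_eq ?_)
  rw [div_pow, Real.sq_sqrt v.coe_nonneg, Real.sq_sqrt (by positivity)]
  congr 4
  field_simp

/-- The data say nothing along a kernel direction, so the posterior keeps the prior variance `T²`
there and a fixed ball receives mass of order at most `1/T`. -/
theorem bayesLimsup_of_singular (hcov : (covMatrix PX).PosDef) (hd : 0 < d) (hn : 0 < n)
    (hf : Measurable f) {v : ℝ≥0} (hv : 0 < v) {t : ℝ} (ht : 0 < t)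
    {x : Fin n → EuclideanSpace ℝ (Fin d)} (hx : (sampleCov x).rank < d) :
    bayesLimsup PX f v t x = 0 := by
  obtain ⟨e, l, -, hl, hgram, hrank, -⟩ := whitenedCov_eigen hcov hd hn x
  obtain ⟨j₀, hj₀⟩ := hrank.1 hx
  have hv' : (0 : ℝ) < v := by exact_mod_cast hv
  have hb : ∀ k : ℕ, bayesMass PX f v t (k + 1) x
      ≤ ENNReal.ofReal (Real.exp 1 / √(1 + ((k : ℝ) + 1) ^ 2 / t)) := by
    intro k
    have hT : (0 : ℝ) < k + 1 := by positivity
    refine (bayesMass_le_trace hcov hf hv ht hT x e l hl hgram).trans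
      (ENNReal.ofReal_le_ofReal ?_)
    have h1 : ((k : ℝ) + 1) ^ 2 ≤ ∑ j, v / (n * l j + v / ((k : ℝ) + 1) ^ 2) := by
      have h2 : ((k : ℝ) + 1) ^ 2 = v / (n * l j₀ + v / ((k : ℝ) + 1) ^ 2) := by
        rw [hj₀]; field_simp; ring
      conv_lhs => rw [h2]
      refine Finset.single_le_sum (f := fun j => (v : ℝ) / (n * l j + v / ((k : ℝ) + 1) ^ 2))
        (fun j _ => ?_) (Finset.mem_univ j₀)
      have := hl j
      positivity
    gcongr
  have hlim : Filter.Tendsto (fun k : ℕ => Real.exp 1 / √(1 + ((k : ℝ) + 1) ^ 2 / t))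
      Filter.atTop (nhds 0) := by
    refine Filter.Tendsto.const_div_atTop (Real.tendsto_sqrt_atTop.comp
      (Filter.tendsto_atTop_add_const_left _ _ (Filter.Tendsto.atTop_div_const ht ?_))) _
    exact (Filter.tendsto_pow_atTop two_ne_zero).comp
      (Filter.tendsto_atTop_add_const_right _ _ tendsto_natCast_atTop_atTop)
  simpa [bayesLimsup] using limsup_le_ofReal hb hlim

/-- In the limit the posterior variances become `v / (n * l j)`, whose sum is `v / n` times the
trace of the inverse. -/
theorem bayesLimsup_le_trace (hcov : (covMatrix PX).PosDef) (hd : 0 < d) (hn : 0 < n)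
    (hf : Measurable f) {v : ℝ≥0} (hv : 0 < v) {t : ℝ} (ht : 0 < t)
    {x : Fin n → EuclideanSpace ℝ (Fin d)} (hx : ¬ (sampleCov x).rank < d) {q : ℝ≥0}
    (hq : q < traceInv (whitenedCov PX x)) :
    bayesLimsup PX f v t x ≤ ENNReal.ofReal (Real.exp 1 / √(1 + v / n * q / t)) := by
  obtain ⟨e, l, -, hl, hgram, hrank, htr, -⟩ := whitenedCov_eigen hcov hd hn x
  have hv' : (0 : ℝ) < v := by exact_mod_cast hv
  have hn' : (0 : ℝ) < n := by exact_mod_cast hn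
  have hpos : ∀ j, 0 < l j := fun j =>
    lt_of_le_of_ne (hl j) fun h0 => hx (hrank.2 ⟨j, h0.symm⟩)
  rw [htr hpos, ENNReal.lt_ofReal_iff_toReal_lt (by simp)] at hq
  have hlim : Filter.Tendsto (fun k : ℕ => Real.exp 1
      / √(1 + (∑ j, v / (n * l j + v / ((k : ℝ) + 1) ^ 2)) / t))
      Filter.atTop (nhds (Real.exp 1 / √(1 + (∑ j, v / (n * l j + 0)) / t))) := by
    have h0 : 0 < 1 + (∑ j, v / (n * l j + 0)) / t := by
      have : 0 ≤ ∑ j, v / (n * l j + 0) := Finset.sum_nonneg fun j _ => by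
        have := hpos j
        positivity
      positivity
    refine Filter.Tendsto.div tendsto_const_nhds ((Real.continuous_sqrt.tendsto _).comp
      (Filter.Tendsto.add tendsto_const_nhds (Filter.Tendsto.div_const
        (tendsto_finsetSum _ fun j _ => Filter.Tendsto.div tendsto_const_nhds
          (tendsto_const_nhds.add (tendsto_div_nat_sq _)) ?_) _))) (Real.sqrt_pos.2 h0).ne'
    have := hpos j
    positivity
  refine (limsup_le_ofReal (fun k => bayesMass_le_trace hcov hf hv ht (by positivity) x e l hl
    hgram) hlim).trans (ENNReal.ofReal_le_ofReal ?_)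
  have h1 : (v : ℝ) / n * q ≤ ∑ j, v / (n * l j + 0) := by
    have h2 : ∑ j, (v : ℝ) / (n * l j + 0) = v / n * ∑ j, (l j)⁻¹ := by
      rw [Finset.mul_sum]
      refine Finset.sum_congr rfl fun j _ => ?_
      have := hpos j
      rw [add_zero]
      field_simp
    rw [h2]
    have : (q : ℝ) ≤ ∑ j, (l j)⁻¹ := by simpa using hq.le
    gcongr
  gcongr

theorem bayesLimsup_le_lambdaMin (hcov : (covMatrix PX).PosDef) (hd : 0 < d) (hn : 0 < n)
    (hf : Measurable f) {v : ℝ≥0} (hv : 0 < v) {t : ℝ} (ht : 0 < t)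
    (x : Fin n → EuclideanSpace ℝ (Fin d)) :
    bayesLimsup PX f v t x ≤ ENNReal.ofReal
      (1 - 1 / 4 * Real.exp (-(9 * t * (n * lambdaMin (whitenedCov PX x)) / v))) := by
  obtain ⟨e, l, -, hl, hgram, -, -, -, -, k₀, hk₀⟩ := whitenedCov_eigen hcov hd hn x
  rw [hk₀]
  refine limsup_le_ofReal (fun k => bayesMass_le_eigenvalue hcov hf hv ht (by positivity) x e l hl
    hgram k₀) ?_
  have h : Filter.Tendsto (fun k : ℕ => n * l k₀ + v / ((k : ℝ) + 1) ^ 2) Filter.atTop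
      (nhds (n * l k₀ + 0)) := tendsto_const_nhds.add (tendsto_div_nat_sq _)
  rw [add_zero] at h
  exact tendsto_const_nhds.sub (tendsto_const_nhds.mul
    ((Real.continuous_exp.tendsto _).comp (((h.const_mul (9 * t)).div_const _).neg)))

/-- A lower bound on the minimax risk from a bound on the asymptotic Bayesian mass. -/
theorem le_minimaxQuantileRisk_gaussClass [IsProbabilityMeasure PX] (hmom : MemLp id 2 PX)
    (hcov : (covMatrix PX).PosDef) (hd : 0 < d) (hn : 0 < n) {v : ℝ≥0} (hv : 0 < v) {δ : ℝ}
    (hδ : 0 < δ) (hδ' : δ < (1 - singularProb PX n) / 4) {t : ℝ≥0} (ht : 0 < t)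
    {ψ : (Fin n → EuclideanSpace ℝ (Fin d)) → ℝ} (hψ : Integrable ψ (designLaw PX n))
    (hψ0 : ∀ x, 0 ≤ ψ x) (hψ4 : ∫ x, ψ x ∂(designLaw PX n) < 1 - singularProb PX n - 4 * δ)
    (hb : ∀ f : (Fin n → EuclideanSpace ℝ (Fin d) × ℝ) → EuclideanSpace ℝ (Fin d), Measurable f →
      ∀ x, ¬ (sampleCov x).rank < d →
        bayesLimsup PX f v t x ≤ ENNReal.ofReal (3 / 4 + 1 / 4 * ψ x)) :
    t ≤ minimaxQuantileRisk n (singularProb PX n + δ) squareError (gaussClass PX v) := by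
  refine le_iInf₂ fun f hf => ?_
  by_contra hlt
  rw [not_le] at hlt
  have hp : ∀ w, ENNReal.ofReal (1 - (singularProb PX n + δ))
      ≤ Measure.pi (fun _ : Fin n => gaussLaw PX v w)
        {D | ‖euclOp (sqrtCov PX) (f D - w)‖ ^ 2 / 2 ≤ t} := by
    intro w
    have h1 : quantileRisk n (singularProb PX n + δ) squareError (gaussLaw PX v w) f < t :=
      lt_of_le_of_lt (le_iSup₂_of_le (gaussLaw PX v w) ⟨w, rfl⟩ le_rfl) hlt
    have h2 := le_measureReal_of_quantile_lt h1
    have hset : {D | ENNReal.ofReal (excessError squareError (gaussLaw PX v w) (f D))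
        ≤ (t : ℝ≥0∞)} = {D | ‖euclOp (sqrtCov PX) (f D - w)‖ ^ 2 / 2 ≤ t} := by
      ext D
      simp only [Set.mem_ofPred_eq, excessError_gaussLaw hmom hcov]
      rw [ENNReal.ofReal_le_iff_le_toReal ENNReal.coe_ne_top, ENNReal.coe_toReal]
    rw [hset] at h2
    exact (ENNReal.ofReal_le_ofReal h2).trans_eq ofReal_measureReal
  have h3 := le_lintegral_bayesLimsup hf v t hp
  set N := {x : Fin n → EuclideanSpace ℝ (Fin d) | (sampleCov x).rank < d} with hN
  have hNm : MeasurableSet N := measurableSet_rank_lt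
  have i1 : Integrable (fun x => 3 / 4 * Nᶜ.indicator (1 : (Fin n → EuclideanSpace ℝ (Fin d)) → ℝ) x) (designLaw PX n) :=
    ((integrable_const 1).indicator hNm.compl).const_mul _
  have h4 : ∫⁻ x, bayesLimsup PX f v t x ∂(designLaw PX n)
      ≤ ENNReal.ofReal (∫ x, (3 / 4 * Nᶜ.indicator (1 : (Fin n → EuclideanSpace ℝ (Fin d)) → ℝ) x + 1 / 4 * ψ x)
        ∂(designLaw PX n)) := by
    have i2 : Integrable (fun x => 3 / 4 * Nᶜ.indicator (1 : (Fin n → EuclideanSpace ℝ (Fin d)) → ℝ) x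
        + 1 / 4 * ψ x) (designLaw PX n) := i1.add (hψ.const_mul _)
    rw [ofReal_integral_eq_lintegral_ofReal i2
      (Filter.Eventually.of_forall fun x => ?_)]
    · refine lintegral_mono fun x => ?_
      by_cases hx : x ∈ N
      · rw [bayesLimsup_of_singular hcov hd hn hf hv (by exact_mod_cast ht) hx]
        exact zero_le
      · have hx' : x ∈ Nᶜ := hx
        rw [Set.indicator_of_mem hx']
        simpa using hb f hf x hx
    · have h5 : 0 ≤ Nᶜ.indicator (1 : (Fin n → EuclideanSpace ℝ (Fin d)) → ℝ) x := Set.indicator_nonneg (by simp) x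
      have := hψ0 x
      simp only [Pi.zero_apply]
      positivity
  have h5 := h3.trans h4
  rw [integral_add i1 (hψ.const_mul _), integral_const_mul, integral_const_mul,
    integral_indicator_one hNm.compl, singular_real_compl, ENNReal.ofReal_le_ofReal_iff'] at h5
  -- The first case reads `1 - ε - δ ≤ 3/4 (1 - ε) + 1/4 ∫ ψ`, that is `∫ ψ ≥ 1 - ε - 4δ`. The
  -- second, `1 - ε - δ ≤ 0`, contradicts the range of `δ`.
  rcases h5 with h5 | h5 <;> linarith

/-! ### Calibration of the radius and the two quantile bounds -/

theorem exp_one_div_sqrt_le : Real.exp 1 / √(1 + 3214) ≤ 3 / 4 := by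
  have h1 : (56 : ℝ) ≤ √(1 + 3214) := Real.le_sqrt_of_sq_le (by norm_num)
  rw [div_le_iff₀ (by positivity)]
  generalize √(1 + 3214 : ℝ) = s at *
  linarith [Real.exp_one_lt_d9]

theorem traceQuantile_le_minimaxQuantileRisk [IsProbabilityMeasure PX] (hmom : MemLp id 2 PX)
    (hcov : (covMatrix PX).PosDef) (hd : 0 < d) (hn : 0 < n) {v : ℝ≥0} (hv : 0 < v) {δ : ℝ}
    (hδ : 0 < δ) (hδ' : δ < (1 - singularProb PX n) / 4) {q : ℝ≥0}
    (hq : q < traceQuantile PX n (1 - singularProb PX n - 4 * δ)) :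
    ((v / n / 3214 * q : ℝ≥0) : ℝ≥0∞)
      ≤ minimaxQuantileRisk n (singularProb PX n + δ) squareError (gaussClass PX v) := by
  rcases eq_or_ne q 0 with rfl | hq0
  · simp
  have hq' : (0 : ℝ) < q := by exact_mod_cast pos_iff_ne_zero.2 hq0
  have hv' : (0 : ℝ) < v := by exact_mod_cast hv
  have hn' : (0 : ℝ) < n := by exact_mod_cast hn
  have ht : 0 < v / n / 3214 * q := by
    have hn'' : (0 : ℝ≥0) < n := by exact_mod_cast hn
    have := pos_iff_ne_zero.2 hq0
    positivity
  set A := {x : Fin n → EuclideanSpace ℝ (Fin d) | traceInv (whitenedCov PX x) ≤ q} with hA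
  have hAm : MeasurableSet A := measurableSet_le measurable_traceInv_whitenedCov measurable_const
  refine le_minimaxQuantileRisk_gaussClass hmom hcov hd hn hv hδ hδ' ht
    (ψ := A.indicator 1) ((integrable_const 1).indicator hAm)
    (fun x => Set.indicator_nonneg (by simp) x) ?_ fun f hf x hx => ?_
  · rw [integral_indicator_one hAm]
    by_contra h
    exact hq.not_ge (quantile_le_coe (not_lt.1 h))
  · by_cases hxA : x ∈ A
    · rw [Set.indicator_of_mem hxA]
      -- Only the trivial bound by `1` is needed where the trace is at most `q`.
      have h1 := bayesLimsup_le_lambdaMin hcov hd hn hf hv (t := (v / n / 3214 * q : ℝ≥0))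
        (by exact_mod_cast ht) x
      refine h1.trans (ENNReal.ofReal_le_ofReal ?_)
      have := Real.exp_pos (-(9 * ((v / n / 3214 * q : ℝ≥0) : ℝ)
        * (n * lambdaMin (whitenedCov PX x)) / v))
      simp only [Pi.one_apply]
      linarith
    · rw [Set.indicator_of_notMem hxA]
      refine (bayesLimsup_le_trace hcov hd hn hf hv (by exact_mod_cast ht) hx
        (not_le.1 hxA)).trans (ENNReal.ofReal_le_ofReal ?_)
      -- The radius makes this ratio constant. A ratio `K` works here as soon as `1 + K ≥ (4e/3)²`,
      -- about `13.14`, so `3214` leaves ample room.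
      have h2 : (v : ℝ) / n * q / ((v / n / 3214 * q : ℝ≥0) : ℝ) = 3214 := by
        push_cast
        field_simp
      rw [h2]
      linarith [exp_one_div_sqrt_le]

/-- Here `ψ = 1 - exp (-λ_min q)` is the conditional probability of `W ≤ q`. The single-coordinate
bound already has the form `3/4 + ψ/4`, up to the rate factor `9/3214 ≤ 1`. -/
theorem expQuantile_le_minimaxQuantileRisk [IsProbabilityMeasure PX] (hmom : MemLp id 2 PX)
    (hcov : (covMatrix PX).PosDef) (hd : 0 < d) (hn : 0 < n) {v : ℝ≥0} (hv : 0 < v) {δ : ℝ}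
    (hδ : 0 < δ) (hδ' : δ < (1 - singularProb PX n) / 4) {q : ℝ≥0}
    (hq : q < expQuantile PX n (1 - singularProb PX n - 4 * δ)) :
    ((v / n / 3214 * q : ℝ≥0) : ℝ≥0∞)
      ≤ minimaxQuantileRisk n (singularProb PX n + δ) squareError (gaussClass PX v) := by
  rcases eq_or_ne q 0 with rfl | hq0
  · simp
  have hv' : (0 : ℝ) < v := by exact_mod_cast hv
  have hn' : (0 : ℝ) < n := by exact_mod_cast hn
  have hn'' : (0 : ℝ≥0) < n := by exact_mod_cast hn
  have ht : 0 < v / n / 3214 * q := by have := pos_iff_ne_zero.2 hq0; positivity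
  refine le_minimaxQuantileRisk_gaussClass hmom hcov hd hn hv hδ hδ' ht
    (integrable_one_sub_exp hcov hd hn q) (fun x => ?_) ?_ fun f hf x hx => ?_
  · have := mul_nonneg (lambdaMin_whitenedCov_nonneg (PX := PX) hcov hd hn x) q.2
    rw [sub_nonneg, Real.exp_le_one_iff]
    simpa using this
  · rw [← jointLaw_real_le hcov hd hn]
    by_contra h
    exact hq.not_ge (quantile_le_coe (not_lt.1 h))
  · refine (bayesLimsup_le_lambdaMin hcov hd hn hf hv (by exact_mod_cast ht) x).trans
      (ENNReal.ofReal_le_ofReal ?_)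
    have h0 := mul_nonneg (lambdaMin_whitenedCov_nonneg (PX := PX) hcov hd hn x) q.2
    have h1 : Real.exp (-(lambdaMin (whitenedCov PX x) * q))
        ≤ Real.exp (-(9 * ((v / n / 3214 * q : ℝ≥0) : ℝ)
          * (n * lambdaMin (whitenedCov PX x)) / v)) := by
      apply Real.exp_le_exp.2
      have h2 : 9 * ((v / n / 3214 * q : ℝ≥0) : ℝ) * (n * lambdaMin (whitenedCov PX x)) / v
          = 9 / 3214 * (lambdaMin (whitenedCov PX x) * q) := by
        push_cast
        field_simp
      rw [h2]
      have h3 : 0 ≤ lambdaMin (whitenedCov PX x) * (q : ℝ) := h0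
      linarith
    linarith

/-- Approaching `Q` from below by finite values also covers `Q = ∞`. -/
theorem mul_le_of_forall_coe_lt {Q L : ℝ≥0∞} {c : ℝ≥0} (hc : c ≠ 0)
    (h : ∀ q : ℝ≥0, q < Q → ((c * q : ℝ≥0) : ℝ≥0∞) ≤ L) : c * Q ≤ L := by
  have hc0 : (c : ℝ≥0∞) ≠ 0 := by simpa using hc
  have h1 : Q ≤ L / c := by
    refine ENNReal.le_of_forall_nnreal_lt fun q hq => ?_
    rw [ENNReal.le_div_iff_mul_le (Or.inl hc0) (Or.inl (by simp)), mul_comm]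
    exact_mod_cast h q hq
  rwa [ENNReal.le_div_iff_mul_le (Or.inl hc0) (Or.inl (by simp)), mul_comm] at h1

theorem quantiles_le_minimaxQuantileRisk [IsProbabilityMeasure PX] (hmom : MemLp id 2 PX)
    (hcov : (covMatrix PX).PosDef) (hd : 0 < d) (hn : 0 < n) {v : ℝ≥0} (hv : 0 < v) {δ : ℝ}
    (hδ : 0 < δ) (hδ' : δ < (1 - singularProb PX n) / 4) :
    (1 / 6428) * ((v : ℝ≥0∞) / n) *
        (traceQuantile PX n (1 - singularProb PX n - 4 * δ)
          + expQuantile PX n (1 - singularProb PX n - 4 * δ))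
      ≤ minimaxQuantileRisk n (singularProb PX n + δ) squareError (gaussClass PX v) := by
  have hn0 : (n : ℝ≥0) ≠ 0 := by exact_mod_cast hn.ne'
  have hc : v / n / 3214 ≠ 0 := by positivity
  have h1 := mul_le_of_forall_coe_lt hc fun q hq =>
    traceQuantile_le_minimaxQuantileRisk hmom hcov hd hn hv hδ hδ' hq
  have h2 := mul_le_of_forall_coe_lt hc fun q hq =>
    expQuantile_le_minimaxQuantileRisk hmom hcov hd hn hv hδ hδ' hq
  set L := minimaxQuantileRisk n (singularProb PX n + δ) squareError (gaussClass PX v)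
  -- `6428 = 2 * 3214`: the sum of quantiles is bounded by averaging the two separate bounds.
  have hcc : (1 / 6428) * ((v : ℝ≥0∞) / n) = 2⁻¹ * ((v / n / 3214 : ℝ≥0) : ℝ≥0∞) := by
    have h3 : ((v / n / 3214 : ℝ≥0) : ℝ≥0∞) = (v : ℝ≥0∞) / n * 3214⁻¹ := by
      rw [ENNReal.coe_div (by norm_num), ENNReal.coe_div hn0, ← div_eq_mul_inv]
      simp
    rw [h3, mul_comm ((v : ℝ≥0∞) / n) 3214⁻¹, ← mul_assoc, one_div,
      ← ENNReal.mul_inv (by simp) (by simp)]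
    norm_num
  rw [hcc, mul_assoc, mul_add]
  calc _ ≤ 2⁻¹ * (L + L) := by gcongr
    _ = L := by rw [← two_mul, ← mul_assoc, ENNReal.inv_mul_cancel (by simp) (by simp), one_mul]

end LowerBound

end QuantileRegression

open QuantileRegression in
theorem proposition2p5 {d n : ℕ} (hd : 0 < d) (hn : 0 < n)
    (PX : Measure (EuclideanSpace ℝ (Fin d))) [IsProbabilityMeasure PX]
    (hmom : MemLp id 2 PX)
    (hsupp : ∀ w : EuclideanSpace ℝ (Fin d), w ≠ 0 → PX {x | ⟪w, x⟫ = 0} < 1)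
    (v : ℝ≥0) (hv : 0 < v)
    (δ : ℝ) (hδ : 0 < δ) (hδ' : δ < (1 - singularProb PX n) / 4) :
    minimaxQuantileRisk n (singularProb PX n + δ) squareError (gaussClass PX v)
        ≤ 2 * ((v : ℝ≥0∞) / n) *
          (traceQuantile PX n (1 - singularProb PX n - δ / 2)
            + expQuantile PX n (1 - singularProb PX n - δ / 2)) ∧
      (1 / 6428) * ((v : ℝ≥0∞) / n) *
          (traceQuantile PX n (1 - singularProb PX n - 4 * δ)
            + expQuantile PX n (1 - singularProb PX n - 4 * δ))
        ≤ minimaxQuantileRisk n (singularProb PX n + δ) squareError (gaussClass PX v) := by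
  have hcov := posDef_covMatrix hmom hsupp
  exact ⟨minimaxQuantileRisk_gaussClass_le hmom hcov hd hn hv δ,
    quantiles_le_minimaxQuantileRisk hmom hcov hd hn hv hδ hδ'⟩
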